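/- Let $p$ be a prime and let $\mathcal{F}$ be a saturated fusion system over a finite $p$-group $S$. Call $Q\le S$ *fully normalised* if $|N_S(Q)|\ge |N_S(P)|$ for every $\mathcal{F}$-conjugate $P$ of $Q$, *centric* if $C_S(P)=Z(P)$ for every $\mathcal{F}$-conjugate $P$ of $Q$, and *radical* if $O_p(\mathrm{Out}_{\mathcal{F}}(Q))=1$. Let $\mathcal{F}^{fcr}$ be the set of subgroups of $S$ that are fully normalised, centric and radical, and let $\mathcal{F}^{e}$ be the set of *essential* subgroups, that is, the fully normalised centric subgroups $Q\le S$ such that $\mathrm{Out}_{\mathcal{F}}(Q)$ has a strongly $p$-embedded subgroup. Let $O_p(\mathcal{F})$ be the largest subgroup of $S$ that is normal in $\mathcal{F}$, and for $Q \le S$ let $N_{\mathcal{F}}(Q)$ be the normaliser of $Q$ in $\mathcal{F}$, a fusion system over $N_S(Q)$. The local rank is defined recursively by $\mathrm{rank}_l(\mathcal{F})=0$ if $O_p(\mathcal{F})=S$, and $$\mathrm{rank}_l(\mathcal{F})=1+\max\{\mathrm{rank}_l(N_{\mathcal{F}}(R)) \mid R\in\mathcal{F}^{fcr},\ O_p(\mathcal{F})<R\}$$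 if $O_p(\mathcal{F})<S$. Then $\mathrm{rank}_l(\mathcal{F})=2$ if and only if both of the following hold: 1. $\mathcal{F}^{e}\setminus\{O_p(\mathcal{F})\}\neq\emptyset$; 2. $N_{\mathcal{F}}(Q)^{e}=\{Q\}$ for every $Q\in\mathcal{F}^{fcr}\setminus\{S,O_p(\mathcal{F})\}$. -/

import Mathlib

universe u

section

/-- `O_p(K)`: the largest normal `p`-subgroup of a finite group `K`. -/
def pCore (p : ℕ) (K : Type*) [Group K] : Subgroup K :=
  sSup {N : Subgroup K | N.Normal ∧ IsPGroup p N}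

/-- `H` is a strongly `p`-embedded subgroup of `K`: `H` is a proper subgroup of order divisible
by `p`, and `H ∩ xHx⁻¹` has order prime to `p` for every `x ∉ H`. -/
def StronglyEmbedded (p : ℕ) {K : Type*} [Group K] (H : Subgroup K) : Prop :=
  H < ⊤ ∧ p ∣ Nat.card H ∧
    ∀ x : K, x ∉ H → ¬ p ∣ Nat.card (H ⊓ H.map (MulAut.conj x).toMonoidHom : Subgroup K)

variable {G : Type u} [Group G]

/-- The normaliser `N_S(Q)`. -/
def relNormalizer (S Q : Subgroup G) : Subgroup G := S ⊓ Subgroup.normalizer (Q : Set G)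

/-- `Aut_S(Q)`: the automorphisms of `Q` induced by conjugation by elements of `N_S(Q)`. -/
def autBy (S Q : Subgroup G) : Subgroup (MulAut Q) :=
  (S.subgroupOf (Subgroup.normalizer (Q : Set G))).map Q.normalizerMonoidHom

/-- For an isomorphism `φ : P → Q`, the subgroup `N_φ` of all `g ∈ N_S(P)` such that
`φ ∘ c_g ∘ φ⁻¹` lies in `Aut_S(Q)`, where `c_g` is conjugation by `g` on `P`. -/
def extensionDomain (S : Subgroup G) {P Q : Subgroup G} (φ : P ≃* Q) : Subgroup G :=
  S ⊓ ((autBy S Q).comap ((MulAut.congr φ).toMonoidHom.comp P.normalizerMonoidHom)).map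
    (Subgroup.normalizer (P : Set G)).subtype

/-- A fusion system over a subgroup `S` of an ambient group: a category whose objects are the
subgroups of `S` and whose morphisms are injective group homomorphisms, containing all the
conjugations by elements of `S`, in which every morphism is an isomorphism of the category
followed by an inclusion. (Identities and inclusions are conjugations by `1`.)
The morphism sets are indexed by all subgroups of the ambient group, and those that do not
connect two subgroups of `S` are empty. -/
@[ext]
structure FusionSystem (S : Subgroup G) where
  /-- The set `Hom_F(P, Q)`. -/
  Hom : ∀ P Q : Subgroup G, Set (P →* Q)
  le_left : ∀ {P Q : Subgroup G} {φ : P →* Q}, φ ∈ Hom P Q → P ≤ S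
  le_right : ∀ {P Q : Subgroup G} {φ : P →* Q}, φ ∈ Hom P Q → Q ≤ S
  injective : ∀ {P Q : Subgroup G} {φ : P →* Q}, φ ∈ Hom P Q → Function.Injective φ
  comp_mem : ∀ {P Q R : Subgroup G} {φ : P →* Q} {ψ : Q →* R},
    φ ∈ Hom P Q → ψ ∈ Hom Q R → ψ.comp φ ∈ Hom P R
  conj_mem : ∀ {P Q : Subgroup G}, P ≤ S → Q ≤ S → ∀ φ : P →* Q,
    (∃ s ∈ S, ∀ x : P, (φ x : G) = s * x * s⁻¹) → φ ∈ Hom P Q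
  factor : ∀ {P Q : Subgroup G} {φ : P →* Q}, φ ∈ Hom P Q →
    ∃ (R : Subgroup G) (hR : R ≤ Q) (e : P ≃* R), e.toMonoidHom ∈ Hom P R ∧
      e.symm.toMonoidHom ∈ Hom R P ∧ φ = (Subgroup.inclusion hR).comp e.toMonoidHom

namespace FusionSystem

variable {S : Subgroup G} (F : FusionSystem S)

/-- `Iso_F(P, Q)`: the isomorphisms of the category `F`. -/
def Iso (P Q : Subgroup G) : Set (P ≃* Q) :=
  {e | e.toMonoidHom ∈ F.Hom P Q ∧ e.symm.toMonoidHom ∈ F.Hom Q P}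

/-- `P` and `Q` are subgroups of `S` that are isomorphic in `F`. -/
def IsConj (P Q : Subgroup G) : Prop := (F.Iso P Q).Nonempty

/-- The group `Aut_F(Q)`, for `Q ≤ S`. -/
def aut {Q : Subgroup G} (hQ : Q ≤ S) : Subgroup (MulAut Q) where
  carrier := F.Iso Q Q
  mul_mem' ha hb := ⟨F.comp_mem hb.1 ha.1, F.comp_mem ha.2 hb.2⟩
  one_mem' := ⟨F.conj_mem hQ hQ _ ⟨1, S.one_mem, fun x => by simp⟩,
    F.conj_mem hQ hQ _ ⟨1, S.one_mem, fun x => by simp [MulAut.one_def]⟩⟩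
  inv_mem' ha := ⟨ha.2, ha.1⟩

/-- `Inn(Q)` as a subgroup of `Aut_F(Q)`. -/
def inn {Q : Subgroup G} (hQ : Q ≤ S) : Subgroup (F.aut hQ) :=
  (MulAut.conj (G := Q)).range.subgroupOf (F.aut hQ)

instance inn_normal {Q : Subgroup G} (hQ : Q ≤ S) : (F.inn hQ).Normal := by
  have h : ((MulAut.conj (G := Q)).range).Normal := by
    constructor
    rintro _ ⟨q, rfl⟩ a
    refine ⟨a q, ?_⟩
    ext x
    simp
  exact h.subgroupOf _

/-- `Out_F(Q) = Aut_F(Q) / Inn(Q)`, for `Q ≤ S`. -/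
abbrev Out {Q : Subgroup G} (hQ : Q ≤ S) : Type u := F.aut hQ ⧸ F.inn hQ

/-- `Q` is fully `F`-automised: `Aut_S(Q)` is a Sylow `p`-subgroup of `Aut_F(Q)`. -/
def FullyAutomised (p : ℕ) (Q : Subgroup G) : Prop :=
  ∃ hQ : Q ≤ S, ∃ T : Sylow p (F.aut hQ),
    (T : Subgroup (F.aut hQ)) = (autBy S Q).subgroupOf (F.aut hQ)

/-- `Q` is `F`-receptive: every `F`-isomorphism `φ : P → Q` extends to a morphism `N_φ → S`. -/
def Receptive (Q : Subgroup G) : Prop :=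
  Q ≤ S ∧ ∀ (P : Subgroup G), ∀ φ ∈ F.Iso P Q, ∃ ψ ∈ F.Hom (extensionDomain S φ) S,
    ∀ (x : P) (y : extensionDomain S φ), (y : G) = x → (ψ y : G) = φ x

/-- `F` is saturated. -/
def Saturated (p : ℕ) : Prop :=
  ∀ P : Subgroup G, P ≤ S → ∃ Q, F.IsConj P Q ∧ F.FullyAutomised p Q ∧ F.Receptive Q

/-- `Q` is fully `F`-normalised. -/
def FullyNormalised (Q : Subgroup G) : Prop :=
  Q ≤ S ∧ ∀ P, F.IsConj P Q → Nat.card (relNormalizer S P) ≤ Nat.card (relNormalizer S Q)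

/-- `Q` is `F`-centric: `C_S(P) = Z(P)` for every `F`-conjugate `P` of `Q`. -/
def Centric (Q : Subgroup G) : Prop :=
  Q ≤ S ∧ ∀ P, F.IsConj P Q →
    S ⊓ Subgroup.centralizer (P : Set G) = (Subgroup.center P).map P.subtype

/-- `Q` is `F`-radical: `O_p(Out_F(Q)) = 1`. -/
def Radical (p : ℕ) (Q : Subgroup G) : Prop :=
  ∃ hQ : Q ≤ S, pCore p (F.Out hQ) = ⊥

/-- The set of fully normalised, centric and radical subgroups. -/
def fcr (p : ℕ) : Set (Subgroup G) :=
  {Q | F.FullyNormalised Q ∧ F.Centric Q ∧ F.Radical p Q}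

/-- The set of essential subgroups: the fully normalised centric subgroups `Q` such that
`Out_F(Q)` has a strongly `p`-embedded subgroup. -/
def essential (p : ℕ) : Set (Subgroup G) :=
  {Q | F.FullyNormalised Q ∧ F.Centric Q ∧
    ∃ hQ : Q ≤ S, ∃ H : Subgroup (F.Out hQ), StronglyEmbedded p H}

/-- `φ : U → V` extends to an `F`-morphism `ψ : UQ → VQ` with `ψ(Q) = Q`. (Wherever this is used,
`U` and `V` normalise `Q`, so that the join of `U` and `Q` is the product `UQ`.) -/
def ExtendsStabilising (Q : Subgroup G) {U V : Subgroup G} (φ : U →* V) : Prop :=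
  ∃ ψ ∈ F.Hom (U ⊔ Q) (V ⊔ Q),
    (∀ (x : U) (y : ↥(U ⊔ Q)), (y : G) = x → (ψ y : G) = φ x) ∧
    (Q.subgroupOf (U ⊔ Q)).map ((V ⊔ Q).subtype.comp ψ) = Q

/-- The normaliser `N_F(Q)` of a subgroup `Q ≤ S`, a fusion system over `N_S(Q)`. -/
def normalizer (Q : Subgroup G) (hQ : Q ≤ S) : FusionSystem (relNormalizer S Q) where
  Hom U V := {φ | U ≤ relNormalizer S Q ∧ V ≤ relNormalizer S Q ∧ φ ∈ F.Hom U V ∧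
    F.ExtendsStabilising Q φ}
  le_left h := h.1
  le_right h := h.2.1
  injective h := F.injective h.2.2.1
  comp_mem := by
    rintro U V W φ φ' ⟨hU, hV, hφ, ψ, hψ, hext, hst⟩ ⟨-, hW, hφ', ψ', hψ', hext', hst'⟩
    refine ⟨hU, hW, F.comp_mem hφ hφ', ψ'.comp ψ, F.comp_mem hψ hψ', ?_, ?_⟩
    · intro x y hxy
      exact hext' (φ x) (ψ y) (hext x y hxy)
    · have h : (Q.subgroupOf (U ⊔ Q)).map ψ = Q.subgroupOf (V ⊔ Q) := by
        apply Subgroup.map_injective (V ⊔ Q).subtype_injective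
        rw [Subgroup.map_map, hst, Subgroup.subgroupOf_map_subtype, inf_eq_left.2 le_sup_right]
      rw [← MonoidHom.comp_assoc, ← Subgroup.map_map, h, hst']
  conj_mem := by
    rintro U V hU hV φ ⟨s, ⟨hsS, hsN⟩, hφ⟩
    have hUQ : U ⊔ Q ≤ S := sup_le (hU.trans inf_le_left) hQ
    have hVQ : V ⊔ Q ≤ S := sup_le (hV.trans inf_le_left) hQ
    have hmap : U ⊔ Q ≤ (V ⊔ Q).comap (MulAut.conj s).toMonoidHom := by
      refine sup_le ?_ ?_
      · intro x hx
        have : s * x * s⁻¹ = φ ⟨x, hx⟩ := (hφ ⟨x, hx⟩).symm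
        simp only [Subgroup.mem_comap, MulEquiv.coe_toMonoidHom, MulAut.conj_apply, this]
        exact le_sup_left (a := V) (φ ⟨x, hx⟩).2
      · intro x hx
        simp only [Subgroup.mem_comap, MulEquiv.coe_toMonoidHom, MulAut.conj_apply]
        exact le_sup_right (a := V) ((hsN x).1 hx)
    let ψ : ↥(U ⊔ Q) →* ↥(V ⊔ Q) :=
      ((MulAut.conj s).toMonoidHom.comp (U ⊔ Q).subtype).codRestrict (V ⊔ Q)
        (fun x => hmap x.2)
    have hψ : ∀ x : ↥(U ⊔ Q), (ψ x : G) = s * x * s⁻¹ := fun _ => rfl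
    refine ⟨hU, hV, F.conj_mem (hU.trans inf_le_left) (hV.trans inf_le_left) φ ⟨s, hsS, hφ⟩,
      ψ, F.conj_mem hUQ hVQ ψ ⟨s, hsS, hψ⟩, ?_, ?_⟩
    · intro x y hxy
      rw [hψ, hφ, hxy]
    · ext z
      simp only [Subgroup.mem_map, Subgroup.mem_subgroupOf, MonoidHom.comp_apply,
        Subgroup.subtype_apply, hψ]
      constructor
      · rintro ⟨x, hx, rfl⟩
        exact (hsN _).1 hx
      · intro hz
        have hz' : s⁻¹ * z * s ∈ Q := (hsN _).2 (by simpa [mul_assoc] using hz)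
        exact ⟨⟨s⁻¹ * z * s, le_sup_right (a := U) hz'⟩, hz', by simp [mul_assoc]⟩
  factor := by
    rintro U V φ ⟨hU, hV, hφ, ψ, hψ, hext, hst⟩
    obtain ⟨R, hR, e, he, hes, hφe⟩ := F.factor hφ
    obtain ⟨T, hT, f, hf, hfs, hψf⟩ := F.factor hψ
    have hvale : ∀ x : U, (φ x : G) = e x := fun x => by rw [hφe]; rfl
    have hvalf : ∀ x : ↥(U ⊔ Q), (ψ x : G) = f x := fun x => by rw [hψf]; rfl
    have hTR : T = R ⊔ Q := by
      have h1 : T = (⊤ : Subgroup ↥(U ⊔ Q)).map ((V ⊔ Q).subtype.comp ψ) := by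
        ext z
        simp only [Subgroup.mem_map, Subgroup.mem_top, true_and, MonoidHom.comp_apply,
          Subgroup.subtype_apply, hvalf]
        exact ⟨fun hz => ⟨f.symm ⟨z, hz⟩, by simp⟩, fun ⟨x, hx⟩ => hx ▸ (f x).2⟩
      have h2 : (⊤ : Subgroup ↥(U ⊔ Q)) = U.subgroupOf (U ⊔ Q) ⊔ Q.subgroupOf (U ⊔ Q) := by
        apply Subgroup.map_injective (U ⊔ Q).subtype_injective
        rw [Subgroup.map_sup, Subgroup.subgroupOf_map_subtype, Subgroup.subgroupOf_map_subtype,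
          inf_eq_left.2 le_sup_left, inf_eq_left.2 le_sup_right, ← MonoidHom.range_eq_map,
          Subgroup.range_subtype]
      have h3 : (U.subgroupOf (U ⊔ Q)).map ((V ⊔ Q).subtype.comp ψ) = R := by
        ext z
        simp only [Subgroup.mem_map, Subgroup.mem_subgroupOf, MonoidHom.comp_apply,
          Subgroup.subtype_apply]
        constructor
        · rintro ⟨x, hx, rfl⟩
          rw [hext ⟨x, hx⟩ x rfl, hvale]
          exact (e _).2
        · intro hz
          refine ⟨⟨e.symm ⟨z, hz⟩, le_sup_left (a := U) (e.symm ⟨z, hz⟩).2⟩,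
            (e.symm ⟨z, hz⟩).2, ?_⟩
          rw [hext (e.symm ⟨z, hz⟩) _ rfl, hvale]
          simp
      rw [h1, h2, Subgroup.map_sup, hst, h3]
    subst hTR
    have hRN : R ≤ relNormalizer S Q := hR.trans hV
    refine ⟨R, hR, e, ⟨hU, hRN, he, f.toMonoidHom, hf, ?_, ?_⟩,
      ⟨hRN, hU, hes, f.symm.toMonoidHom, hfs, ?_, ?_⟩, hφe⟩
    · intro x y hxy
      have := hext x y hxy
      rwa [hvale, hvalf] at this
    · have h : (R ⊔ Q).subtype.comp f.toMonoidHom = (V ⊔ Q).subtype.comp ψ := by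
        ext x
        exact (hvalf x).symm
      rw [h, hst]
    · intro x y hxy
      have hx : ((⟨e.symm x, le_sup_left (a := U) (e.symm x).2⟩ : ↥(U ⊔ Q)) : G) = e.symm x := rfl
      have h := hext (e.symm x) _ hx
      rw [hvale, hvalf, MulEquiv.apply_symm_apply, ← hxy] at h
      have h' := (f.eq_symm_apply).2 (Subtype.ext h)
      exact (congrArg Subtype.val h').symm
    · ext z
      simp only [Subgroup.mem_map, Subgroup.mem_subgroupOf, MonoidHom.comp_apply,
        Subgroup.subtype_apply, MulEquiv.coe_toMonoidHom]
      constructor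
      · rintro ⟨x, hx, rfl⟩
        obtain ⟨y, hy, hyx⟩ := hst.ge hx
        have : f y = x := Subtype.ext ((hvalf y).symm.trans hyx)
        rw [← this, MulEquiv.symm_apply_apply]
        exact hy
      · intro hz
        refine ⟨f ⟨z, le_sup_right (a := U) hz⟩, ?_, by simp⟩
        have : ((f ⟨z, le_sup_right (a := U) hz⟩ : ↥(R ⊔ Q)) : G) ∈
            (Q.subgroupOf (U ⊔ Q)).map ((V ⊔ Q).subtype.comp ψ) :=
          ⟨⟨z, le_sup_right (a := U) hz⟩, hz, hvalf _⟩
        rwa [hst] at this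

/-- `Q` is normal in `F`: `Q` is normal in `S`, and every `F`-morphism `U → V` extends to an
`F`-morphism `UQ → VQ` mapping `Q` onto itself, i.e. `N_F(Q) = F`. -/
def IsNormal (Q : Subgroup G) : Prop :=
  Q ≤ S ∧ S ≤ Subgroup.normalizer (Q : Set G) ∧
    ∀ U V : Subgroup G, ∀ φ ∈ F.Hom U V, F.ExtendsStabilising Q φ

/-- `O_p(F)`: the largest subgroup of `S` that is normal in `F` (where `S` is a finite
`p`-group). A product of two normal subgroups of `F` is again normal in `F`. -/
def core : Subgroup G := sSup {Q | F.IsNormal Q}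

theorem core_le : F.core ≤ S := sSup_le fun _ h => h.1

theorem le_core_normalizer (Q : Subgroup G) (hQ : Q ≤ S) : Q ≤ (F.normalizer Q hQ).core := by
  refine le_sSup ⟨le_inf hQ Subgroup.le_normalizer, inf_le_right, ?_⟩
  rintro U V φ ⟨hU, hV, -, ψ, hψ, hext, hst⟩
  have hQN : Q ≤ relNormalizer S Q := le_inf hQ Subgroup.le_normalizer
  have key : ∀ {A B : Subgroup G} (hA : A ≤ relNormalizer S Q) (hB : B ≤ relNormalizer S Q)
      (hQA : Q ≤ A) (hQB : Q ≤ B) (χ : A →* B), χ ∈ F.Hom A B →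
      (Q.subgroupOf A).map (B.subtype.comp χ) = Q → χ ∈ (F.normalizer Q hQ).Hom A B := by
    intro A B hA hB hQA hQB χ hχ hχQ
    refine ⟨hA, hB, hχ, ?_⟩
    have hA' : A ⊔ Q = A := sup_eq_left.2 hQA
    have hB' : B ⊔ Q = B := sup_eq_left.2 hQB
    unfold ExtendsStabilising
    rw [hA', hB']
    refine ⟨χ, hχ, ?_, hχQ⟩
    intro x y hxy
    rw [Subtype.ext hxy]
  exact ⟨ψ, key (sup_le hU hQN) (sup_le hV hQN) le_sup_right le_sup_right ψ hψ hst, hext, hst⟩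

instance finite_relNormalizer (S Q : Subgroup G) [Finite S] : Finite (relNormalizer S Q) :=
  Finite.of_injective _ (Subgroup.inclusion_injective (inf_le_left : relNormalizer S Q ≤ S))

open Classical in
/-- The local rank of a (saturated) fusion system `F` over a finite `p`-group `S`: it is `0` if
`O_p(F) = S`, and otherwise it is one plus the maximum of the local ranks of the fusion systems
`N_F(R)`, over all fully normalised, centric and radical subgroups `R` that properly contain
`O_p(F)`. (The supremum below is over a finite set, hence a maximum whenever the set is nonempty;
if `F` is saturated, `S` belongs to it.) -/
noncomputable def localRank (p : ℕ) {S : Subgroup G} [Finite S] (F : FusionSystem S) : ℕ :=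
  if F.core = S then 0
  else 1 + ⨆ R : {R : Subgroup G // R ∈ F.fcr p ∧ F.core < R},
    localRank p (F.normalizer R.1 R.2.1.1.1)
termination_by Nat.card S - Nat.card F.core
decreasing_by
  have hRS : R.1 ≤ S := R.2.1.1.1
  have hfin : Finite R.1 := Finite.of_injective _ (Subgroup.inclusion_injective hRS)
  have h1 : Nat.card (relNormalizer S R.1) ≤ Nat.card S :=
    Subgroup.card_le_of_le inf_le_left
  have h2 : Nat.card R.1 ≤ Nat.card (F.normalizer R.1 hRS).core := by
    have : Finite (F.normalizer R.1 hRS).core :=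
      Finite.of_injective _ (Subgroup.inclusion_injective (core_le _))
    exact Subgroup.card_le_of_le (F.le_core_normalizer R.1 hRS)
  have h3 : Nat.card F.core < Nat.card R.1 :=
    Set.ncard_lt_ncard (SetLike.coe_ssubset_coe.2 R.2.2) (Set.toFinite _)
  have h4 : Nat.card R.1 ≤ Nat.card S := Subgroup.card_le_of_le hRS
  omega

end FusionSystem

end

/-!
The local rank is controlled by Alperin's fusion theorem, used in the following form
(`extendsToTop_of_disjoint_essential`). Let `X` be a class of subgroups that is closed under
`F`-conjugation and under overgroups, on which `F` is saturated, and which contains no essential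
subgroup. Then every isomorphism between members of `X` extends to an element of `Aut_F(S)`. The
proof is by downward induction on the order. For a fully automised receptive centric `Q < S`, once
the isomorphisms between larger members of `X` are known to extend, the elements of `Aut_F(Q)` that
extend to `S` give a subgroup of `Out_F(Q)` which is strongly `p`-embedded if it is proper. If all of
`Aut_F(T)` extends to `S` then `Aut_S(T)` is a normal `p`-subgroup of `Aut_F(T)`; so if `T` is
centric and radical it is equal to `S`.

Essential subgroups are centric and radical (`essential_subset_fcr`), and `O_p(F)` lies in every
centric radical subgroup (`core_le_of_radical`), whence `O_p(N_F(Q)) = Q` for such `Q`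
(`core_normalizer`). Consequently the local rank is at most one if no subgroup of order larger
than `|O_p(F)|` is essential, and `N_F(Q)` has local rank one if `Q` is its only essential subgroup.
Conversely, if `N_F(Q)` has local rank one then each fully normalised centric radical subgroup
`R > Q` of `N_F(Q)` is its own normaliser in `N_S(Q)`, so that `R = N_S(Q)` is not essential, while
`N_F(Q)` does have an essential subgroup, since otherwise `N_S(Q)` would be normal in it
(`essential_normalizer_nonempty`).

Alperin's theorem is applied to `N_F(Q)` only above `Q`, so only the part of the saturation of
`N_F(Q)` that concerns overgroups of `Q` is needed; this is `exists_isConj_normalizer`.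
-/

/-! ### Sylow subgroups and strongly embedded subgroups of finite groups -/

section GroupTheory
variable {K : Type*} [Group K]

/-- `B` is a Sylow `p`-subgroup of the subgroup `A`: a maximal element among the `p`-subgroups
of the ambient group that are contained in `A`. -/
structure IsSylowIn (p : ℕ) (A B : Subgroup K) : Prop where
  le : B ≤ A
  isPGroup : IsPGroup p B
  eq_of_le : ∀ C : Subgroup K, C ≤ A → IsPGroup p C → B ≤ C → C = B

theorem isSylowIn_iff_exists_sylow {p : ℕ} {A B : Subgroup K} (hBA : B ≤ A) :
    IsSylowIn p A B ↔ ∃ T : Sylow p A, (T : Subgroup A) = B.subgroupOf A := by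
  constructor
  · rintro ⟨-, hB, hmax⟩
    refine ⟨⟨B.subgroupOf A, hB.comap_of_injective _ A.subtype_injective, ?_⟩, rfl⟩
    intro C hC hBC
    have h := hmax (C.map A.subtype) (Subgroup.map_subtype_le C) (hC.map _) (by
      intro b hb
      exact ⟨⟨b, hBA hb⟩, hBC (by simpa [Subgroup.mem_subgroupOf] using hb), rfl⟩)
    rw [← h, Subgroup.subgroupOf, Subgroup.comap_map_eq_self_of_injective A.subtype_injective]
  · rintro ⟨T, hT⟩
    refine ⟨hBA, ?_, ?_⟩
    · have h := T.isPGroup'.map A.subtype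
      change IsPGroup p ((T : Subgroup A).map A.subtype) at h
      rwa [hT, Subgroup.subgroupOf_map_subtype, inf_eq_left.2 hBA] at h
    · intro C hCA hC hBC
      have h := T.is_maximal' (hC.comap_of_injective A.subtype A.subtype_injective) (by
        rw [hT]
        exact Subgroup.comap_mono hBC)
      refine le_antisymm ?_ hBC
      intro c hc
      have h' : (⟨c, hCA hc⟩ : A) ∈ (T : Subgroup A) := by
        rw [← SetLike.mem_coe] at *
        change (⟨c, hCA hc⟩ : A) ∈ (T.toSubgroup : Set A)
        rw [← h]
        exact hc
      rw [hT] at h'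
      exact h'

theorem exists_isSylowIn (p : ℕ) (A : Subgroup K) : ∃ B, IsSylowIn p A B := by
  obtain ⟨T⟩ := (inferInstance : Nonempty (Sylow p A))
  refine ⟨(T : Subgroup A).map A.subtype,
    (isSylowIn_iff_exists_sylow (Subgroup.map_subtype_le _)).2 ⟨T, ?_⟩⟩
  rw [Subgroup.subgroupOf, Subgroup.comap_map_eq_self_of_injective A.subtype_injective]

namespace IsSylowIn

theorem map {L : Type*} [Group L] {p : ℕ} {A B : Subgroup K} (h : IsSylowIn p A B)
    (m : K ≃* L) : IsSylowIn p (A.map m.toMonoidHom) (B.map m.toMonoidHom) := by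
  refine ⟨Subgroup.map_mono h.le, h.isPGroup.map _, ?_⟩
  intro C hCA hC hBC
  have key := h.eq_of_le (C.comap m.toMonoidHom) ?_ (hC.comap_of_injective _ m.injective)
    (Subgroup.map_le_iff_le_comap.1 hBC)
  · rw [← key, Subgroup.map_comap_eq_self_of_surjective m.surjective]
  · intro x hx
    obtain ⟨a, ha, hax⟩ := hCA hx
    rwa [← m.injective hax]

theorem exists_conj_mem {p : ℕ} [Fact p.Prime] [Finite K] {A B C : Subgroup K}
    (h : IsSylowIn p A B) (hCA : C ≤ A) (hC : IsPGroup p C) :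
    ∃ a ∈ A, ∀ c ∈ C, a * c * a⁻¹ ∈ B := by
  obtain ⟨T, hT⟩ := (isSylowIn_iff_exists_sylow h.le).1 h
  obtain ⟨U, hU⟩ := (hC.comap_of_injective A.subtype A.subtype_injective).exists_le_sylow
  obtain ⟨a, ha⟩ := MulAction.exists_smul_eq A U T
  refine ⟨a, a.2, fun c hc => ?_⟩
  have h1 : (⟨c, hCA hc⟩ : A) ∈ U := hU (show c ∈ C from hc)
  have h2 : a * ⟨c, hCA hc⟩ * a⁻¹ ∈ (T : Subgroup A) := by
    rw [← ha]
    exact Subgroup.smul_mem_pointwise_smul _ (MulAut.conj a) _ h1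
  rw [hT] at h2
  exact h2

end IsSylowIn

theorem IsPGroup.dvd_card_of_ne_bot {p : ℕ} [Fact p.Prime] {B : Subgroup K} [Finite B]
    (hB : IsPGroup p B) (h : B ≠ ⊥) : p ∣ Nat.card B := by
  obtain ⟨n, hn, hcard⟩ := hB.nontrivial_iff_card.1 (B.nontrivial_iff_ne_bot.2 h)
  rw [hcard]
  exact dvd_pow_self p hn.ne'

/-- Normalisers grow in finite `p`-groups. -/
theorem IsPGroup.exists_mem_normalizer_notMem {p : ℕ} [Fact p.Prime] {S Q : Subgroup K} [Finite S]
    (hS : IsPGroup p S) (hQS : Q < S) :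
    ∃ g ∈ S, g ∈ Subgroup.normalizer (Q : Set K) ∧ g ∉ Q := by
  have := hS.isNilpotent
  have h1 : Q.subgroupOf S < ⊤ := by
    rw [lt_top_iff_ne_top, Ne, Subgroup.subgroupOf_eq_top]
    exact not_le_of_gt hQS
  obtain ⟨g, hg, hgQ⟩ := SetLike.exists_of_lt (Group.normalizerCondition_of_isNilpotent _ h1)
  refine ⟨g, g.2, ?_, hgQ⟩
  rw [Subgroup.mem_normalizer_iff] at hg ⊢
  intro x
  constructor
  · intro hx
    exact (hg ⟨x, hQS.le hx⟩).1 hx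
  · intro hx
    have hxS : x ∈ S := by
      have h2 := S.mul_mem (S.mul_mem (S.inv_mem g.2) (hQS.le hx)) g.2
      simpa [mul_assoc] using h2
    exact (hg ⟨x, hxS⟩).2 hx

/-- A strongly `p`-embedded subgroup contains a Sylow `p`-subgroup, hence every normal
`p`-subgroup, and such a subgroup lies in all its intersections with its conjugates. -/
theorem StronglyEmbedded.pCore_eq_bot {p : ℕ} [Fact p.Prime] [Finite K] {H : Subgroup K}
    (hH : StronglyEmbedded p H) : pCore p K = ⊥ := by
  obtain ⟨hlt, hdvd, hx⟩ := hH
  refine le_bot_iff.1 (sSup_le ?_)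
  rintro N ⟨hN, hNp⟩
  by_contra hNbot
  obtain ⟨B, hB⟩ := exists_isSylowIn p H
  have hBbot : B ≠ ⊥ := by
    rintro rfl
    obtain ⟨x, hxo⟩ := exists_prime_orderOf_dvd_card' p hdvd
    have h := hB.eq_of_le (Subgroup.zpowers (x : K)) (by simp)
      (IsPGroup.of_card (n := 1) (by rw [Nat.card_zpowers, Subgroup.orderOf_coe, hxo, pow_one]))
      bot_le
    have hx1 : (x : K) = 1 := Subgroup.zpowers_eq_bot.1 h
    rw [← Subgroup.orderOf_coe, hx1, orderOf_one] at hxo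
    exact (Fact.out : p.Prime).one_lt.ne hxo
  obtain ⟨U, hU⟩ := hB.isPGroup.exists_le_sylow
  -- an element of `U` normalising `B` fixes `B ≤ H`, so it lies in `H`
  have hUB : (U : Subgroup K) = B := by
    by_contra hne
    have hBU : B < U := lt_of_le_of_ne hU (Ne.symm hne)
    obtain ⟨g, hgU, hgN, hgB⟩ := U.isPGroup'.exists_mem_normalizer_notMem hBU
    by_cases hgH : g ∈ H
    · apply hgB
      have h := hB.eq_of_le (H ⊓ U) inf_le_left
        (U.isPGroup'.to_le inf_le_right) (le_inf hB.le hU)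
      rw [← h]
      exact ⟨hgH, hgU⟩
    · refine hx g hgH ?_
      have hle : B ≤ H ⊓ H.map (MulAut.conj g).toMonoidHom := by
        refine le_inf hB.le fun b hb => ⟨g⁻¹ * b * g, hB.le ?_, by simp [mul_assoc]⟩
        exact (Subgroup.mem_normalizer_iff.1 hgN _).2 (by simpa [mul_assoc] using hb)
      refine dvd_trans ?_ (Subgroup.card_dvd_of_le hle)
      exact hB.isPGroup.dvd_card_of_ne_bot hBbot
  have hNH : N ≤ H := by
    refine le_trans ?_ hB.le
    rw [← hUB]
    have h := U.is_maximal' (IsPGroup.to_sup_of_normal_right U.isPGroup' hNp) le_sup_left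
    intro n hn
    have h2 : n ∈ U.toSubgroup ⊔ N := le_sup_right (a := U.toSubgroup) hn
    rwa [h] at h2
  obtain ⟨g, -, hg⟩ := SetLike.exists_of_lt hlt
  refine hx g hg ?_
  have hle : N ≤ H ⊓ H.map (MulAut.conj g).toMonoidHom := by
    refine le_inf hNH fun n hn => ⟨g⁻¹ * n * g, hNH ?_, by simp [mul_assoc]⟩
    simpa using hN.conj_mem n hn g⁻¹
  refine dvd_trans ?_ (Subgroup.card_dvd_of_le hle)
  exact hNp.dvd_card_of_ne_bot fun h => hNbot h.le

theorem pCore_quotient_eq_bot_iff {p : ℕ} {I : Subgroup K} [I.Normal] (hI : IsPGroup p I) :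
    pCore p (K ⧸ I) = ⊥ ↔ ∀ N : Subgroup K, N.Normal → IsPGroup p N → N ≤ I := by
  constructor
  · intro h N hN hNp
    have h1 : N.map (QuotientGroup.mk' I) ≤ pCore p (K ⧸ I) :=
      le_sSup ⟨hN.map _ (QuotientGroup.mk'_surjective I), hNp.map _⟩
    rwa [h, le_bot_iff, Subgroup.map_eq_bot_iff, QuotientGroup.ker_mk'] at h1
  · intro h
    refine le_bot_iff.1 (sSup_le ?_)
    rintro N ⟨hN, hNp⟩
    have h1 := h (N.comap (QuotientGroup.mk' I)) (hN.comap _)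
      (hNp.comap_of_ker_isPGroup _ (by rwa [QuotientGroup.ker_mk']))
    rw [← Subgroup.map_comap_eq_self_of_surjective (QuotientGroup.mk'_surjective I) N, le_bot_iff,
      Subgroup.map_eq_bot_iff, QuotientGroup.ker_mk']
    exact h1

/-- A criterion for strongly embedded subgroups of a quotient: if the proper subgroup `H`
contains a Sylow `p`-subgroup `P` and every element that conjugates some element of `P \ I`
into `P`, then `H / I` is strongly `p`-embedded. -/
theorem stronglyEmbedded_map_mk {p : ℕ} [Fact p.Prime] [Finite K] {I H P : Subgroup K} [I.Normal]
    (hI : IsPGroup p I) (hIH : I ≤ H) (hH : H < ⊤) (hP : IsSylowIn p ⊤ P) (hPH : P ≤ H)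
    (hPI : ¬ P ≤ I)
    (hfus : ∀ z : K, (∃ g ∈ P, g ∉ I ∧ z * g * z⁻¹ ∈ P) → z ∈ H) :
    StronglyEmbedded p (H.map (QuotientGroup.mk' I)) := by
  have hmem : ∀ x : K, QuotientGroup.mk' I x ∈ H.map (QuotientGroup.mk' I) → x ∈ H := by
    intro x hx
    have h : x ∈ (H.map (QuotientGroup.mk' I)).comap (QuotientGroup.mk' I) := hx
    rwa [QuotientGroup.comap_map_mk', sup_eq_right.2 hIH] at h
  refine ⟨?_, ?_, ?_⟩
  · rw [lt_top_iff_ne_top]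
    intro htop
    obtain ⟨x, -, hx⟩ := SetLike.exists_of_lt hH
    exact hx (hmem x (htop ▸ Subgroup.mem_top _))
  · refine dvd_trans ?_ (Subgroup.card_dvd_of_le (Subgroup.map_mono hPH))
    refine (hP.isPGroup.map _).dvd_card_of_ne_bot ?_
    rw [Ne, Subgroup.map_eq_bot_iff, QuotientGroup.ker_mk']
    exact hPI
  · intro x' hx' hdvd
    obtain ⟨x, rfl⟩ := QuotientGroup.mk'_surjective I x'
    obtain ⟨y', hy'⟩ := exists_prime_orderOf_dvd_card' p hdvd
    have hy1 : (y' : K ⧸ I) ≠ 1 := by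
      intro h1
      rw [← Subgroup.orderOf_coe, h1, orderOf_one] at hy'
      exact (Fact.out : p.Prime).one_lt.ne hy'
    obtain ⟨y, hy⟩ := QuotientGroup.mk'_surjective I (y' : K ⧸ I)
    -- the full preimage of the subgroup of order `p` generated by `y'`
    let C := (Subgroup.zpowers (y' : K ⧸ I)).comap (QuotientGroup.mk' I)
    have hC : IsPGroup p C := by
      refine IsPGroup.comap_of_ker_isPGroup (IsPGroup.of_card (n := 1) ?_) _ (by
        rwa [QuotientGroup.ker_mk'])
      rw [Nat.card_zpowers, Subgroup.orderOf_coe, hy', pow_one]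
    have hCH : C ≤ H := by
      intro c hc
      refine hmem c ?_
      have h : Subgroup.zpowers (y' : K ⧸ I) ≤ H.map (QuotientGroup.mk' I) := by
        rw [Subgroup.zpowers_le]
        exact y'.2.1
      exact h hc
    have hCH' : C.map (MulAut.conj x⁻¹).toMonoidHom ≤ H := by
      rintro _ ⟨c, hc, rfl⟩
      refine hmem _ ?_
      have h : Subgroup.zpowers (y' : K ⧸ I) ≤
          (H.map (QuotientGroup.mk' I)).map
            (MulAut.conj (QuotientGroup.mk' I x)).toMonoidHom := by
        rw [Subgroup.zpowers_le]
        exact y'.2.2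
      obtain ⟨w, hw, hwc⟩ := h hc
      have hwc' : QuotientGroup.mk' I x * w * (QuotientGroup.mk' I x)⁻¹ =
        QuotientGroup.mk' I c := hwc
      have : QuotientGroup.mk' I (x⁻¹ * c * x⁻¹⁻¹) = w := by
        rw [map_mul, map_mul, ← hwc']
        simp [mul_assoc]
      exact this ▸ hw
    have hPH' : IsSylowIn p H P := ⟨hPH, hP.isPGroup, fun C _ hC hPC => hP.eq_of_le C le_top hC hPC⟩
    obtain ⟨a, haH, ha⟩ := hPH'.exists_conj_mem hCH hC
    obtain ⟨b, hbH, hb⟩ := hPH'.exists_conj_mem hCH' (hC.map _)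
    have hyC : y ∈ C := by
      rw [Subgroup.mem_comap]
      rw [hy]
      exact Subgroup.mem_zpowers _
    have hyI : y ∉ I := by
      intro h
      exact hy1 (hy ▸ (QuotientGroup.eq_one_iff y).2 h)
    have hz : b * x⁻¹ * a⁻¹ ∈ H := by
      refine hfus _ ⟨a * y * a⁻¹, ha y hyC, ?_, ?_⟩
      · intro h
        apply hyI
        have h2 := (inferInstance : I.Normal).conj_mem _ h a⁻¹
        simpa [mul_assoc] using h2
      · have h2 := hb _ ⟨y, hyC, rfl⟩
        simp only [MulEquiv.coe_toMonoidHom, MulAut.conj_apply] at h2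
        convert h2 using 1
        group
    apply hx'
    refine ⟨x, ?_, rfl⟩
    rw [SetLike.mem_coe]
    have h := H.inv_mem (H.mul_mem (H.mul_mem (H.inv_mem hbH) hz) haH)
    convert h using 1
    group

end GroupTheory

/-! ### Isomorphisms of a fusion system as functions on the ambient group -/

section Conjugation
variable {G : Type u} [Group G] {S P Q : Subgroup G}

theorem mem_autBy {a : MulAut Q} : a ∈ autBy S Q ↔
    ∃ g ∈ S, g ∈ Subgroup.normalizer (Q : Set G) ∧ ∀ x : Q, (a x : G) = g * x * g⁻¹ := by
  constructor
  · rintro ⟨g, hg, rfl⟩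
    exact ⟨g, hg, g.2, fun x => rfl⟩
  · rintro ⟨g, hgS, hgN, h⟩
    refine ⟨⟨g, hgN⟩, hgS, ?_⟩
    ext x
    exact (h x).symm

theorem conj_mem_of_mem_normalizer {g x : G} (hg : g ∈ Subgroup.normalizer (Q : Set G))
    (hx : x ∈ Q) : g * x * g⁻¹ ∈ Q :=
  (Subgroup.mem_normalizer_iff.1 hg x).1 hx

/-- `f` transports conjugation by `g ∈ N_S(P)` on `P` to conjugation by an element of `N_S(Q)`
on `Q`; this describes the elements of `N_f`. -/
def ExtendsAt (S : Subgroup G) (f : G → G) (P Q : Subgroup G) (g : G) : Prop :=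
  g ∈ S ∧ g ∈ Subgroup.normalizer (P : Set G) ∧
    ∃ h ∈ S, h ∈ Subgroup.normalizer (Q : Set G) ∧ ∀ x ∈ P, f (g * x * g⁻¹) = h * f x * h⁻¹

theorem mem_extensionDomain {φ : P ≃* Q} {f : G → G} (hf : ∀ x : P, (φ x : G) = f x) {g : G} :
    g ∈ extensionDomain S φ ↔ ExtendsAt S f P Q g := by
  constructor
  · rintro ⟨hgS, n, hn, rfl⟩
    obtain ⟨h, hhS, hhN, hh⟩ := mem_autBy.1 hn
    refine ⟨hgS, n.2, h, hhS, hhN, fun x hx => ?_⟩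
    have h1 := hh (φ ⟨x, hx⟩)
    simp only [MonoidHom.comp_apply, MulEquiv.coe_toMonoidHom, MulAut.congr_apply] at h1
    simp only [MulEquiv.trans_apply, MulEquiv.symm_apply_apply] at h1
    rw [hf, hf] at h1
    exact h1
  · rintro ⟨hgS, hgN, h, hhS, hhN, hh⟩
    refine ⟨hgS, ⟨g, hgN⟩, mem_autBy.2 ⟨h, hhS, hhN, fun y => ?_⟩, rfl⟩
    obtain ⟨x, rfl⟩ := φ.surjective y
    simp only [MonoidHom.comp_apply, MulEquiv.coe_toMonoidHom, MulAut.congr_apply]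
    simp only [MulEquiv.trans_apply, MulEquiv.symm_apply_apply]
    rw [hf, hf]
    exact hh x x.2

end Conjugation

open scoped Pointwise

namespace FusionSystem
variable {G : Type u} [Group G] {S : Subgroup G} {F : FusionSystem S}
  {P Q R : Subgroup G} {f g : G → G} {p : ℕ}

/-- The restriction of `f` to `P` is an isomorphism `P → Q` of the category `F`. The values of
`f` outside `P` play no role; total functions are used in order that composition and restriction
involve no change of types. -/
def IsoOn (F : FusionSystem S) (f : G → G) (P Q : Subgroup G) : Prop :=
  ∃ e ∈ F.Iso P Q, ∀ x : P, (e x : G) = f x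

theorem exists_isoOn_of_mem_iso {e : P ≃* Q} (he : e ∈ F.Iso P Q) :
    ∃ f, F.IsoOn f P Q ∧ ∀ x : P, (e x : G) = f x := by
  refine ⟨Function.extend Subtype.val (fun x => (e x : G)) 1, ⟨e, he, fun x => ?_⟩, fun x => ?_⟩ <;>
  rw [Subtype.val_injective.extend_apply]

theorem isConj_iff : F.IsConj P Q ↔ ∃ f, F.IsoOn f P Q := by
  constructor
  · rintro ⟨e, he⟩
    obtain ⟨f, hf, -⟩ := exists_isoOn_of_mem_iso he
    exact ⟨f, hf⟩
  · rintro ⟨f, e, he, -⟩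
    exact ⟨e, he⟩

theorem mem_iso_of_isoOn {e : P ≃* Q} (hf : F.IsoOn f P Q) (he : ∀ x : P, (e x : G) = f x) :
    e ∈ F.Iso P Q := by
  obtain ⟨e', he', h⟩ := hf
  have : e = e' := by
    ext x
    rw [he, h]
  rwa [this]

namespace IsoOn

theorem le_left (h : F.IsoOn f P Q) : P ≤ S := by
  obtain ⟨e, he, -⟩ := h
  exact F.le_left he.1

theorem le_right (h : F.IsoOn f P Q) : Q ≤ S := by
  obtain ⟨e, he, -⟩ := h
  exact F.le_right he.1

theorem congr (h : F.IsoOn f P Q) (hfg : ∀ x ∈ P, g x = f x) : F.IsoOn g P Q := by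
  obtain ⟨e, he, hf⟩ := h
  exact ⟨e, he, fun x => by rw [hf, hfg x x.2]⟩

theorem mem (h : F.IsoOn f P Q) {x : G} (hx : x ∈ P) : f x ∈ Q := by
  obtain ⟨e, -, hf⟩ := h
  exact hf ⟨x, hx⟩ ▸ (e ⟨x, hx⟩).2

theorem exists_eq (h : F.IsoOn f P Q) {y : G} (hy : y ∈ Q) : ∃ x ∈ P, f x = y := by
  obtain ⟨e, -, hf⟩ := h
  exact ⟨e.symm ⟨y, hy⟩, (e.symm ⟨y, hy⟩).2, by rw [← hf]; simp⟩

theorem image (h : F.IsoOn f P Q) : f '' P = Q := by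
  ext y
  constructor
  · rintro ⟨x, hx, rfl⟩
    exact h.mem hx
  · exact fun hy => h.exists_eq hy

theorem map_mul (h : F.IsoOn f P Q) {x y : G} (hx : x ∈ P) (hy : y ∈ P) :
    f (x * y) = f x * f y := by
  obtain ⟨e, -, hf⟩ := h
  have h1 := congrArg Subtype.val (e.map_mul ⟨x, hx⟩ ⟨y, hy⟩)
  simpa only [Subgroup.coe_mul, hf] using h1

theorem map_inv (h : F.IsoOn f P Q) {x : G} (hx : x ∈ P) : f x⁻¹ = (f x)⁻¹ := by
  obtain ⟨e, -, hf⟩ := h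
  have h1 := congrArg Subtype.val (_root_.map_inv e ⟨x, hx⟩)
  simpa only [Subgroup.coe_inv, hf] using h1

theorem map_conj (h : F.IsoOn f P Q) {x y : G} (hx : x ∈ P) (hy : y ∈ P) :
    f (x * y * x⁻¹) = f x * f y * (f x)⁻¹ := by
  rw [h.map_mul (P.mul_mem hx hy) (P.inv_mem hx), h.map_mul hx hy, h.map_inv hx]

theorem injOn (h : F.IsoOn f P Q) {x y : G} (hx : x ∈ P) (hy : y ∈ P) (hxy : f x = f y) :
    x = y := by
  obtain ⟨e, -, hf⟩ := h
  have h1 : e ⟨x, hx⟩ = e ⟨y, hy⟩ := Subtype.ext (by rw [hf, hf]; exact hxy)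
  exact congrArg Subtype.val (e.injective h1)

theorem card_eq (h : F.IsoOn f P Q) : Nat.card P = Nat.card Q := by
  obtain ⟨e, -, -⟩ := h
  exact Nat.card_congr e.toEquiv

theorem comp (hg : F.IsoOn g Q R) (hf : F.IsoOn f P Q) : F.IsoOn (g ∘ f) P R := by
  obtain ⟨e, he, hef⟩ := hf
  obtain ⟨e', he', heg⟩ := hg
  refine ⟨e.trans e', ⟨F.comp_mem he.1 he'.1, F.comp_mem he'.2 he.2⟩, fun x => ?_⟩
  rw [MulEquiv.trans_apply, heg, hef, Function.comp_apply]

theorem exists_inverse (h : F.IsoOn f P Q) :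
    ∃ f', F.IsoOn f' Q P ∧ (∀ x ∈ P, f' (f x) = x) ∧ ∀ y ∈ Q, f (f' y) = y := by
  obtain ⟨e, he, hf⟩ := h
  obtain ⟨f', hf', hef'⟩ := exists_isoOn_of_mem_iso (F := F) (e := e.symm) ⟨he.2, he.1⟩
  refine ⟨f', hf', fun x hx => ?_, fun y hy => ?_⟩
  · rw [← hf ⟨x, hx⟩, ← hef']
    simp
  · have h1 := hef' ⟨y, hy⟩
    rw [← h1, ← hf]
    simp

theorem restrict (h : F.IsoOn f P Q) (hRP : R ≤ P) : ∃ Q₁ ≤ Q, F.IsoOn f R Q₁ := by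
  have hP := h.le_left
  obtain ⟨e, he, hf⟩ := h
  have h1 : Subgroup.inclusion hRP ∈ F.Hom R P :=
    F.conj_mem (hRP.trans hP) hP _ ⟨1, S.one_mem, fun x => by simp⟩
  obtain ⟨Q₁, hQ₁, e₁, h2, h3, h4⟩ := F.factor (F.comp_mem h1 he.1)
  refine ⟨Q₁, hQ₁, e₁, ⟨h2, h3⟩, fun x => ?_⟩
  have h5 := congrArg (fun φ : R →* Q => (φ x : G)) h4
  change (e (Subgroup.inclusion hRP x) : G) = e₁ x at h5
  rw [← h5, hf, Subgroup.coe_inclusion]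

theorem restrict_of_image (h : F.IsoOn f P Q) (hRP : R ≤ P) {Q₁ : Subgroup G}
    (hR : f '' R = Q₁) : F.IsoOn f R Q₁ := by
  obtain ⟨Q₂, -, h2⟩ := h.restrict hRP
  have : Q₂ = Q₁ := SetLike.coe_injective (h2.image.symm.trans hR)
  rwa [← this]

theorem of_conj {s : G} (hs : s ∈ S) (hP : P ≤ S) (hQ : Q ≤ S)
    (h : ∀ x, x ∈ P ↔ s * x * s⁻¹ ∈ Q) : F.IsoOn (fun x => s * x * s⁻¹) P Q := by
  have hmap : Q = P.map (MulAut.conj s).toMonoidHom := by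
    ext y
    constructor
    · intro hy
      exact ⟨s⁻¹ * y * s, (h _).2 (by simpa [mul_assoc] using hy), by simp [mul_assoc]⟩
    · rintro ⟨x, hx, rfl⟩
      exact (h x).1 hx
  subst hmap
  refine ⟨P.equivMapOfInjective _ (MulAut.conj s).injective, ⟨?_, ?_⟩, fun x => rfl⟩
  · exact F.conj_mem hP hQ _ ⟨s, hs, fun x => rfl⟩
  · refine F.conj_mem hQ hP _ ⟨s⁻¹, S.inv_mem hs, fun y => ?_⟩
    obtain ⟨x, rfl⟩ := (P.equivMapOfInjective (MulAut.conj s).toMonoidHom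
      (MulAut.conj s).injective).surjective y
    rw [MulEquiv.coe_toMonoidHom, MulEquiv.symm_apply_apply]
    change (x : G) = s⁻¹ * (s * x * s⁻¹) * s⁻¹⁻¹
    simp [mul_assoc]

theorem id (hP : P ≤ S) : F.IsoOn id P P :=
  (of_conj S.one_mem hP hP (by simp)).congr (by simp)

theorem of_conj_normalizer {s : G} (hs : s ∈ S) (hP : P ≤ S)
    (hsP : s ∈ Subgroup.normalizer (P : Set G)) : F.IsoOn (fun x => s * x * s⁻¹) P P :=
  of_conj hs hP hP (Subgroup.mem_normalizer_iff.1 hsP)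

/-- The image of an element normalising `P` normalises the image of `P`. -/
theorem mem_normalizer {M N : Subgroup G} (h : F.IsoOn f M N) (hPM : P ≤ M) (hPQ : F.IsoOn f P Q)
    {x : G} (hx : x ∈ M) (hxP : x ∈ Subgroup.normalizer (P : Set G)) :
    f x ∈ Subgroup.normalizer (Q : Set G) := by
  have key : ∀ x ∈ M, x ∈ Subgroup.normalizer (P : Set G) → ∀ y ∈ Q, f x * y * (f x)⁻¹ ∈ Q := by
    intro x hx hxP y hy
    obtain ⟨z, hz, rfl⟩ := hPQ.exists_eq hy
    rw [← h.map_conj hx (hPM hz)]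
    exact hPQ.mem (conj_mem_of_mem_normalizer hxP hz)
  rw [Subgroup.mem_normalizer_iff]
  refine fun y => ⟨key x hx hxP y, fun hy => ?_⟩
  have h2 := key x⁻¹ (M.inv_mem hx) (Subgroup.inv_mem _ hxP) _ hy
  rw [h.map_inv hx] at h2
  simpa [mul_assoc] using h2

end IsoOn

theorem exists_isoOn_of_mem_hom {φ : P →* Q} (hφ : φ ∈ F.Hom P Q) :
    ∃ f, ∃ R ≤ Q, F.IsoOn f P R ∧ ∀ x : P, (φ x : G) = f x := by
  obtain ⟨R, hR, e, he, hes, rfl⟩ := F.factor hφ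
  obtain ⟨f, hf, hef⟩ := exists_isoOn_of_mem_iso (F := F) ⟨he, hes⟩
  exact ⟨f, R, hR, hf, fun x => hef x⟩

theorem IsoOn.exists_mem_hom (h : F.IsoOn f P R) (hRQ : R ≤ Q) (hQ : Q ≤ S) :
    ∃ φ ∈ F.Hom P Q, ∀ x : P, (φ x : G) = f x := by
  obtain ⟨e, he, hf⟩ := h
  refine ⟨(Subgroup.inclusion hRQ).comp e.toMonoidHom, F.comp_mem he.1
    (F.conj_mem (hRQ.trans hQ) hQ _ ⟨1, S.one_mem, fun x => by simp⟩), fun x => hf x⟩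

theorem mem_aut_iff {hQ : Q ≤ S} {a : MulAut Q} (ha : ∀ x : Q, (a x : G) = f x) :
    a ∈ F.aut hQ ↔ F.IsoOn f Q Q :=
  ⟨fun h => ⟨a, h, ha⟩, fun h => mem_iso_of_isoOn h ha⟩

theorem exists_isoOn_of_mem_aut {hQ : Q ≤ S} {a : MulAut Q} (ha : a ∈ F.aut hQ) :
    ∃ f, F.IsoOn f Q Q ∧ ∀ x : Q, (a x : G) = f x :=
  exists_isoOn_of_mem_iso ha

theorem IsoOn.exists_mem_aut (h : F.IsoOn f Q Q) :
    ∃ a ∈ F.aut h.le_left, ∀ x : Q, (a x : G) = f x := by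
  obtain ⟨a, ha, hf⟩ := h
  exact ⟨a, ha, hf⟩

theorem autBy_le_aut (hQ : Q ≤ S) (hRS : R ≤ S) : autBy R Q ≤ F.aut hQ := by
  intro a ha
  obtain ⟨g, hg, hgN, h⟩ := mem_autBy.1 ha
  exact (mem_aut_iff h).2 (IsoOn.of_conj_normalizer (hRS hg) hQ hgN)

theorem isPGroup_autBy (hR : IsPGroup p R) : IsPGroup p (autBy R Q) :=
  (hR.comap_of_injective _ (Subgroup.subtype_injective _)).map _

/-! ### Fully automised, receptive and fully normalised subgroups -/

theorem finite_of_le [Finite S] (hQ : Q ≤ S) : Finite Q :=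
  Finite.of_injective _ (Subgroup.inclusion_injective hQ)

theorem finite_mulAut [Finite S] (hQ : Q ≤ S) : Finite (MulAut Q) := by
  have := finite_of_le hQ
  exact Finite.of_injective (fun a : MulAut Q => (a : Q → Q)) DFunLike.coe_injective

theorem fullyAutomised_iff : F.FullyAutomised p Q ↔
    ∃ hQ : Q ≤ S, IsSylowIn p (F.aut hQ) (autBy S Q) := by
  constructor
  · rintro ⟨hQ, h⟩
    exact ⟨hQ, (isSylowIn_iff_exists_sylow (autBy_le_aut hQ le_rfl)).2 h⟩
  · rintro ⟨hQ, h⟩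
    exact ⟨hQ, (isSylowIn_iff_exists_sylow (autBy_le_aut hQ le_rfl)).1 h⟩

theorem Receptive.exists_extension (hQ : F.Receptive Q) (hf : F.IsoOn f P Q) :
    ∃ f' N R, F.IsoOn f' N R ∧ P ≤ N ∧ (∀ x ∈ P, f' x = f x) ∧ ∀ g, ExtendsAt S f P Q g → g ∈ N := by
  have hf' := hf
  obtain ⟨e, he, hef⟩ := hf'
  obtain ⟨ψ, hψ, hext⟩ := hQ.2 P e he
  obtain ⟨f', R, -, hR, hψf⟩ := exists_isoOn_of_mem_hom hψ
  have hPN : P ≤ extensionDomain S e := by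
    intro x hx
    exact (mem_extensionDomain hef).2 ⟨hf.le_left hx, Subgroup.le_normalizer hx, f x,
      hf.le_right (hf.mem hx), Subgroup.le_normalizer (hf.mem hx), fun y hy => hf.map_conj hx hy⟩
  refine ⟨f', _, R, hR, hPN, fun x hx => ?_, fun g hg => (mem_extensionDomain hef).2 hg⟩
  rw [← hef ⟨x, hx⟩, ← hext ⟨x, hx⟩ ⟨x, hPN hx⟩ rfl, hψf]

theorem receptive_of_exists_extension (hQ : Q ≤ S)
    (h : ∀ P f, F.IsoOn f P Q → ∃ f' N R, F.IsoOn f' N R ∧ (∀ x ∈ P, f' x = f x) ∧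
      ∀ g, ExtendsAt S f P Q g → g ∈ N) : F.Receptive Q := by
  refine ⟨hQ, fun P e he => ?_⟩
  obtain ⟨f, hf, hef⟩ := exists_isoOn_of_mem_iso he
  obtain ⟨f', N, R, hf', hff, hN⟩ := h P f hf
  have hle : extensionDomain S e ≤ N := fun g hg => hN g ((mem_extensionDomain hef).1 hg)
  obtain ⟨R', -, hR'⟩ := hf'.restrict hle
  obtain ⟨ψ, hψ, hψf⟩ := hR'.exists_mem_hom hR'.le_right le_rfl
  refine ⟨ψ, hψ, fun x y hxy => ?_⟩
  rw [hψf, hef, hxy, hff x x.2]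

/-- Conjugation by an isomorphism of `F` carries `Aut_F(P)` to `Aut_F(Q)`. -/
theorem map_congr_aut {e : P ≃* Q} (he : e ∈ F.Iso P Q) (hP : P ≤ S) (hQ : Q ≤ S) :
    (F.aut hP).map (MulAut.congr e).toMonoidHom = F.aut hQ := by
  have key : ∀ {P Q : Subgroup G} (hP : P ≤ S) (hQ : Q ≤ S) (e : P ≃* Q), e ∈ F.Iso P Q →
      ∀ a ∈ F.aut hP, MulAut.congr e a ∈ F.aut hQ := by
    intro P Q hP hQ e he a ha
    exact ⟨F.comp_mem he.2 (F.comp_mem ha.1 he.1), F.comp_mem he.2 (F.comp_mem ha.2 he.1)⟩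
  apply le_antisymm
  · rintro _ ⟨a, ha, rfl⟩
    exact key hP hQ e he a ha
  · intro b hb
    refine ⟨_, key hQ hP e.symm ⟨he.2, he.1⟩ b hb, ?_⟩
    ext x
    simp [MulAut.congr]

/-- If `f : P → Q` transports a Sylow subgroup of `Aut_F(P)` into `Aut_S(Q)`, then `Aut_S(Q)` is a
Sylow subgroup of `Aut_F(Q)` and consists of the transported automorphisms. -/
theorem IsoOn.fullyAutomised_of_transport (hS : IsPGroup p S) (hf : F.IsoOn f P Q)
    {B : Subgroup (MulAut P)} (hB : IsSylowIn p (F.aut hf.le_left) B)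
    (h : ∀ b ∈ B, ∃ s ∈ S, s ∈ Subgroup.normalizer (Q : Set G) ∧
      ∀ x : P, f (b x) = s * f x * s⁻¹) :
    F.FullyAutomised p Q ∧ ∀ s ∈ S, s ∈ Subgroup.normalizer (Q : Set G) →
      ∃ b ∈ B, ∀ x : P, f (b x) = s * f x * s⁻¹ := by
  have hP := hf.le_left
  have hQ := hf.le_right
  obtain ⟨e, he, hef⟩ := hf
  have hval : ∀ (b : MulAut P) (x : P), (MulAut.congr e b (e x) : G) = f (b x) := by
    intro b x
    rw [← hef]
    simp [MulAut.congr]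
  have hle : B.map (MulAut.congr e).toMonoidHom ≤ autBy S Q := by
    rintro _ ⟨b, hb, rfl⟩
    obtain ⟨s, hs, hsN, hsx⟩ := h b hb
    refine mem_autBy.2 ⟨s, hs, hsN, fun y => ?_⟩
    obtain ⟨x, rfl⟩ := e.surjective y
    rw [hef, ← hsx]
    exact hval b x
  have hsyl := hB.map (MulAut.congr e)
  rw [map_congr_aut he hP hQ] at hsyl
  have heq := hsyl.eq_of_le _ (autBy_le_aut hQ le_rfl) (isPGroup_autBy hS) hle
  rw [← heq] at hsyl
  refine ⟨fullyAutomised_iff.2 ⟨hQ, hsyl⟩, fun s hs hsN => ?_⟩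
  obtain ⟨a, ha, has⟩ := (IsoOn.of_conj_normalizer (F := F) hs hQ hsN).exists_mem_aut
  have ha' : a ∈ autBy S Q := mem_autBy.2 ⟨s, hs, hsN, has⟩
  rw [heq] at ha'
  obtain ⟨b, hb, rfl⟩ := ha'
  refine ⟨b, hb, fun x => ?_⟩
  rw [← hval, ← hef]
  exact has (e x)

/-- If `Q` is fully automised then every isomorphism `P → Q` may be composed with an element of
`Aut_F(Q)` in such a way that a given `p`-subgroup of `Aut_F(P)` is transported into
`Aut_S(Q)`. -/
theorem FullyAutomised.exists_transport [Fact p.Prime] [Finite S] (hQ : F.FullyAutomised p Q)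
    (hf : F.IsoOn f P Q) {B : Subgroup (MulAut P)} (hBA : B ≤ F.aut hf.le_left)
    (hB : IsPGroup p B) :
    ∃ f', F.IsoOn f' P Q ∧ ∀ b ∈ B, ∃ s ∈ S, s ∈ Subgroup.normalizer (Q : Set G) ∧
      ∀ x : P, f' (b x) = s * f' x * s⁻¹ := by
  obtain ⟨hQS, hsyl⟩ := fullyAutomised_iff.1 hQ
  have hP := hf.le_left
  have := finite_mulAut hQS
  have hf' := hf
  obtain ⟨e, he, hef⟩ := hf'
  obtain ⟨a, ha, hconj⟩ := hsyl.exists_conj_mem (C := B.map (MulAut.congr e).toMonoidHom)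
    (by rw [← map_congr_aut he hP hQS]; exact Subgroup.map_mono hBA) (hB.map _)
  obtain ⟨g, hg, hag⟩ := exists_isoOn_of_mem_aut ha
  refine ⟨g ∘ f, hg.comp hf, fun b hb => ?_⟩
  obtain ⟨s, hs, hsN, hsx⟩ := mem_autBy.1 (hconj _ ⟨b, hb, rfl⟩)
  refine ⟨s, hs, hsN, fun x => ?_⟩
  have h1 := hsx (a (e x))
  have h2 : (a * (MulAut.congr e).toMonoidHom b * a⁻¹) (a (e x)) = a (e (b x)) := by
    simp [MulAut.congr]
  rw [h2, hag, hag, hef, hef] at h1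
  exact h1

/-- Every isomorphism onto a fully automised receptive subgroup `Q` agrees, up to `Aut_F(Q)`, with
one that extends to the normaliser of its source. -/
theorem exists_extension_relNormalizer [Fact p.Prime] [Finite S] (hS : IsPGroup p S)
    (hQ : F.FullyAutomised p Q) (hQ' : F.Receptive Q) (hPQ : F.IsConj P Q) :
    ∃ f, F.IsoOn f P Q ∧ ∃ R ≤ relNormalizer S Q, F.IsoOn f (relNormalizer S P) R := by
  obtain ⟨f₀, hf₀⟩ := isConj_iff.1 hPQ
  obtain ⟨f, hf, htr⟩ := hQ.exists_transport hf₀ (autBy_le_aut hf₀.le_left le_rfl)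
    (isPGroup_autBy hS)
  obtain ⟨f', N, R, hf', hPN, hff, hN⟩ := hQ'.exists_extension hf
  have hle : relNormalizer S P ≤ N := by
    rintro g ⟨hgS, hgN⟩
    obtain ⟨b, -, hb⟩ := (IsoOn.of_conj_normalizer (F := F) hgS hf.le_left hgN).exists_mem_aut
    obtain ⟨s, hs, hsN, hsx⟩ := htr b (mem_autBy.2 ⟨g, hgS, hgN, hb⟩)
    refine hN g ⟨hgS, hgN, s, hs, hsN, fun x hx => ?_⟩
    have h1 := hsx ⟨x, hx⟩
    rwa [hb] at h1
  have hfP : F.IsoOn f' P Q := hf.congr hff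
  obtain ⟨R', -, hR'⟩ := hf'.restrict hle
  refine ⟨f', hfP, R', fun y hy => ⟨hR'.le_right hy, ?_⟩, hR'⟩
  obtain ⟨x, hx, rfl⟩ := hR'.exists_eq hy
  exact hR'.mem_normalizer (le_inf hf.le_left Subgroup.le_normalizer) hfP hx hx.2

theorem fullyNormalised_of_fullyAutomised_of_receptive [Fact p.Prime] [Finite S]
    (hS : IsPGroup p S) (hQ : F.FullyAutomised p Q) (hQ' : F.Receptive Q) :
    F.FullyNormalised Q := by
  refine ⟨hQ'.1, fun P hPQ => ?_⟩
  obtain ⟨f, -, R, hR, hf⟩ := exists_extension_relNormalizer hS hQ hQ' hPQ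
  rw [hf.card_eq]
  exact Subgroup.card_le_of_le hR

/-- In a saturated fusion system, a fully normalised subgroup is fully automised and receptive:
its normaliser is isomorphic in `F` to that of a conjugate with these properties. -/
theorem FullyNormalised.fullyAutomised_and_receptive [Fact p.Prime] [Finite S]
    (hS : IsPGroup p S) (hF : F.Saturated p) (hQ : F.FullyNormalised Q) :
    F.FullyAutomised p Q ∧ F.Receptive Q := by
  obtain ⟨P, hQP, hP, hP'⟩ := hF Q hQ.1
  obtain ⟨f, hf, R, hR, hfN⟩ := exists_extension_relNormalizer hS hP hP' hQP
  have hRP : R = relNormalizer S P := by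
    have h1 : Nat.card (relNormalizer S P) ≤ Nat.card R := by
      rw [← hfN.card_eq]
      obtain ⟨e, he⟩ := hQP
      exact hQ.2 P ⟨e.symm, he.2, he.1⟩
    exact Subgroup.eq_of_le_of_card_ge hR h1
  subst hRP
  obtain ⟨f', hf', hff, hff'⟩ := hfN.exists_inverse
  have hQN : Q ≤ relNormalizer S Q := le_inf hQ.1 Subgroup.le_normalizer
  have hf'P : F.IsoOn f' P Q := by
    refine hf'.restrict_of_image (le_inf hP'.1 Subgroup.le_normalizer) ?_
    rw [← hf.image, Set.image_image]
    ext x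
    constructor
    · rintro ⟨y, hy, rfl⟩
      dsimp only
      rw [hff y (hQN hy)]
      exact hy
    · exact fun hx => ⟨x, hx, hff x (hQN hx)⟩
  have hPN : P ≤ relNormalizer S P := le_inf hP'.1 Subgroup.le_normalizer
  constructor
  · obtain ⟨hPS, hsyl⟩ := fullyAutomised_iff.1 hP
    refine (hf'P.fullyAutomised_of_transport hS hsyl fun b hb => ?_).1
    obtain ⟨g, hgS, hgN, hg⟩ := mem_autBy.1 hb
    refine ⟨f' g, (hf'.mem ⟨hgS, hgN⟩).1, (hf'.mem ⟨hgS, hgN⟩).2, fun x => ?_⟩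
    rw [hg, hf'.map_conj ⟨hgS, hgN⟩ (hPN x.2)]
  · refine receptive_of_exists_extension hQ.1 fun U θ hθ => ?_
    obtain ⟨θ', N, M, hθ', hUN, hext, hN⟩ := hP'.exists_extension (hf.comp hθ)
    -- on `N_θ` the extension of `f ∘ θ` takes its values in `N_S(P)`, where `f` has an inverse
    have hdom : ∀ g, ExtendsAt S θ U Q g → g ∈ N ∧ g ∈ Subgroup.normalizer (U : Set G) := by
      rintro g ⟨hgS, hgN, h, hhS, hhN, hh⟩
      refine ⟨hN g ⟨hgS, hgN, f h, (hfN.mem ⟨hhS, hhN⟩).1, (hfN.mem ⟨hhS, hhN⟩).2, ?_⟩, hgN⟩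
      intro x hx
      rw [Function.comp_apply, hh x hx, hfN.map_conj ⟨hhS, hhN⟩ (hQN (hθ.mem hx))]
      rfl
    have hUP : F.IsoOn θ' U P := (hf.comp hθ).congr hext
    obtain ⟨M₁, -, hM₁⟩ := hθ'.restrict (R := N ⊓ Subgroup.normalizer (U : Set G)) inf_le_left
    have hM₁N : M₁ ≤ relNormalizer S P := by
      intro y hy
      refine ⟨hM₁.le_right hy, ?_⟩
      obtain ⟨x, hx, rfl⟩ := hM₁.exists_eq hy
      exact hM₁.mem_normalizer (le_inf hUN Subgroup.le_normalizer) hUP hx hx.2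
    obtain ⟨M₂, -, hM₂⟩ := hf'.restrict hM₁N
    refine ⟨f' ∘ θ', _, M₂, hM₂.comp hM₁, fun x hx => ?_, hdom⟩
    rw [Function.comp_apply, hext x hx, Function.comp_apply, hff _ (hQN (hθ.mem hx))]

/-! ### Normalisers of subgroups -/

theorem isoOn_normalizer_of_isoOn {hQ : Q ≤ S} (hf : F.IsoOn f P R) (hQP : Q ≤ P)
    (hP : P ≤ relNormalizer S Q) (hR : R ≤ relNormalizer S Q) (hfQ : f '' Q = Q) :
    (F.normalizer Q hQ).IsoOn f P R := by
  have hQR : Q ≤ R := by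
    intro x hx
    rw [← SetLike.mem_coe, ← hfQ] at hx
    obtain ⟨y, hy, rfl⟩ := hx
    exact hf.mem (hQP hy)
  have key : ∀ {A B : Subgroup G} {χ : A →* B} {g : G → G}, A ≤ relNormalizer S Q →
      B ≤ relNormalizer S Q → Q ≤ A → Q ≤ B → χ ∈ F.Hom A B → (∀ x : A, (χ x : G) = g x) →
      g '' Q = Q → χ ∈ (F.normalizer Q hQ).Hom A B := by
    intro A B χ g hA hB hQA hQB hχ hg hgQ
    refine ⟨hA, hB, hχ, ?_⟩
    have hA' : A ⊔ Q = A := sup_eq_left.2 hQA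
    have hB' : B ⊔ Q = B := sup_eq_left.2 hQB
    unfold ExtendsStabilising
    rw [hA', hB']
    refine ⟨χ, hχ, fun x y hxy => by rw [Subtype.ext hxy], ?_⟩
    refine SetLike.coe_injective (Eq.trans ?_ hgQ)
    ext z
    constructor
    · rintro ⟨x, hx, rfl⟩
      exact ⟨x, hx, (hg x).symm⟩
    · rintro ⟨x, hx, rfl⟩
      exact ⟨⟨x, hQA hx⟩, hx, hg _⟩
  obtain ⟨g, hg, hgf, -⟩ := hf.exists_inverse
  have hgQ : g '' Q = Q := by
    ext x
    constructor
    · rintro ⟨y, hy, rfl⟩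
      rw [SetLike.mem_coe, ← SetLike.mem_coe, ← hfQ] at hy
      obtain ⟨x, hx, rfl⟩ := hy
      rw [hgf x (hQP hx)]
      exact hx
    · intro hx
      exact ⟨f x, hfQ.le ⟨x, hx, rfl⟩, hgf x (hQP hx)⟩
  obtain ⟨e, he, hef⟩ := hf
  refine ⟨e, ⟨key hP hR hQP hQR he.1 hef hfQ, key hR hP hQR hQP he.2 (fun y => ?_) hgQ⟩, hef⟩
  obtain ⟨x, rfl⟩ := e.surjective y
  rw [hef, hgf x x.2]
  simp

/-- Morphisms of `N_F(Q)` extend over `Q`. -/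
theorem IsoOn.exists_extension_of_normalizer {hQ : Q ≤ S}
    (hf : (F.normalizer Q hQ).IsoOn f P R) :
    ∃ f', F.IsoOn f' (P ⊔ Q) (R ⊔ Q) ∧ (∀ x ∈ P, f' x = f x) ∧ f' '' Q = Q := by
  obtain ⟨e, ⟨⟨-, -, he, ψ, hψ, hext, hst⟩, -⟩, hef⟩ := hf
  obtain ⟨f', M, hM, hf', hψf⟩ := exists_isoOn_of_mem_hom hψ
  have hff : ∀ x ∈ P, f' x = f x := by
    intro x hx
    rw [← hef ⟨x, hx⟩]
    have h1 := hext ⟨x, hx⟩ ⟨x, (le_sup_left : P ≤ P ⊔ Q) hx⟩ rfl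
    rw [hψf] at h1
    exact h1
  have hfQ : f' '' Q = Q := by
    rw [← hst]
    ext z
    constructor
    · rintro ⟨x, hx, rfl⟩
      exact ⟨⟨x, (le_sup_right : Q ≤ P ⊔ Q) (hst.le hx)⟩, hst.le hx, hψf _⟩
    · rintro ⟨x, hx, rfl⟩
      exact ⟨x, hst.ge hx, (hψf x).symm⟩
  have hMe : M = R ⊔ Q := by
    refine le_antisymm hM (sup_le ?_ ?_)
    · intro y hy
      have h1 := hf'.mem ((le_sup_left : P ≤ P ⊔ Q) (e.symm ⟨y, hy⟩).2)
      rw [hff _ (e.symm ⟨y, hy⟩).2, ← hef] at h1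
      simpa using h1
    · intro y hy
      rw [← SetLike.mem_coe, ← hfQ] at hy
      obtain ⟨x, hx, rfl⟩ := hy
      exact hf'.mem ((le_sup_right : Q ≤ P ⊔ Q) hx)
  subst hMe
  exact ⟨f', hf', hff, hfQ⟩

theorem IsoOn.of_normalizer {hQ : Q ≤ S} (hf : (F.normalizer Q hQ).IsoOn f P R) :
    F.IsoOn f P R := by
  obtain ⟨e, he, hef⟩ := hf
  exact ⟨e, ⟨he.1.2.2.1, he.2.2.2.1⟩, hef⟩

theorem IsoOn.image_of_normalizer {hQ : Q ≤ S} (hf : (F.normalizer Q hQ).IsoOn f P R)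
    (hQP : Q ≤ P) : f '' Q = Q := by
  obtain ⟨f', -, hff, hfQ⟩ := hf.exists_extension_of_normalizer
  conv_rhs => rw [← hfQ]
  exact Set.image_congr fun x hx => (hff x (hQP hx)).symm

/-- The part of the saturation of `N_F(Q)` that concerns subgroups containing `Q`. -/
theorem exists_isConj_normalizer [Fact p.Prime] [Finite S] (hS : IsPGroup p S)
    (hF : F.Saturated p) (hQ : F.FullyNormalised Q) (hQP : Q ≤ P) (hP : P ≤ relNormalizer S Q) :
    ∃ R, (F.normalizer Q hQ.1).IsConj P R ∧ (F.normalizer Q hQ.1).FullyAutomised p R ∧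
      (F.normalizer Q hQ.1).Receptive R := by
  obtain ⟨hQa, hQr⟩ := hQ.fullyAutomised_and_receptive hS hF
  obtain ⟨P₀, hPP₀, hP₀, hP₀'⟩ := hF P (hP.trans inf_le_left)
  obtain ⟨φ₀, hφ₀⟩ := isConj_iff.1 hPP₀
  obtain ⟨B, hB⟩ := exists_isSylowIn p ((F.normalizer Q hQ.1).aut hP)
  have hBA : B ≤ F.aut hφ₀.le_left := by
    intro b hb
    have h1 := hB.le hb
    exact ⟨h1.1.2.2.1, h1.2.2.2.1⟩
  -- transport `Aut_{N_F(Q)}(P)` to the subgroup `P₀`, so that a Sylow subgroup lands in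
  -- `Aut_S(P₀)`, and then move the image `Q₀` of `Q` back to `Q` by a map defined on `N_S(Q₀)`
  obtain ⟨φ, hφ, hφB⟩ := hP₀.exists_transport hφ₀ hBA hB.isPGroup
  obtain ⟨Q₀, hQ₀, hφQ⟩ := hφ.restrict hQP
  have hconj : F.IsConj Q₀ Q := by
    obtain ⟨g, hg, -⟩ := hφQ.exists_inverse
    exact isConj_iff.2 ⟨g, hg⟩
  obtain ⟨χ, hχQ, M, hM, hχ⟩ := exists_extension_relNormalizer hS hQa hQr hconj
  have hP₀N : P₀ ≤ relNormalizer S Q₀ := by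
    intro y hy
    refine ⟨hφ.le_right hy, ?_⟩
    obtain ⟨x, hx, rfl⟩ := hφ.exists_eq hy
    exact hφ.mem_normalizer hQP hφQ hx (hP hx).2
  obtain ⟨R, hRM, hχP⟩ := hχ.restrict hP₀N
  have hχφ : F.IsoOn (χ ∘ φ) P R := hχP.comp hφ
  have hE : (F.normalizer Q hQ.1).IsoOn (χ ∘ φ) P R :=
    isoOn_normalizer_of_isoOn hχφ hQP hP (hRM.trans hM) (hχQ.comp hφQ).image
  have hQR : Q ≤ R := fun x hx => by
    obtain ⟨y, hy, rfl⟩ := hχQ.exists_eq hx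
    exact hχP.mem (hQ₀ hy)
  have hfa := hE.fullyAutomised_of_transport (hS.to_le inf_le_left) hB fun b hb => by
    obtain ⟨s, hs, hsN, hsx⟩ := hφB b hb
    have hbQ : ∀ x ∈ Q, ∃ y : P, (y : G) ∈ Q ∧ (b y : G) = x := by
      obtain ⟨g, hg, hbg⟩ := exists_isoOn_of_mem_aut (hB.le hb)
      intro x hx
      have h1 := hg.image_of_normalizer hQP
      rw [← SetLike.mem_coe, ← h1] at hx
      obtain ⟨y, hy, rfl⟩ := hx
      exact ⟨⟨y, hQP hy⟩, hy, hbg _⟩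
    have hbQ' : ∀ x ∈ Q, ∀ hx : x ∈ P, (b ⟨x, hx⟩ : G) ∈ Q := by
      obtain ⟨g, hg, hbg⟩ := exists_isoOn_of_mem_aut (hB.le hb)
      intro x hxQ hx
      have h1 := hg.image_of_normalizer hQP
      rw [hbg, ← SetLike.mem_coe, ← h1]
      exact ⟨x, hxQ, rfl⟩
    have hsQ₀ : s ∈ Subgroup.normalizer (Q₀ : Set G) := by
      rw [Subgroup.mem_normalizer_iff]
      intro y
      constructor
      · intro hy
        obtain ⟨x, hx, rfl⟩ := hφQ.exists_eq hy
        rw [← hsx ⟨x, hQP hx⟩]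
        exact hφQ.mem (hbQ' x hx _)
      · intro hy
        obtain ⟨x, hx, hxy⟩ := hφQ.exists_eq hy
        obtain ⟨z, hzQ, rfl⟩ := hbQ x hx
        rw [hsx z] at hxy
        have : φ z = y := by simpa using hxy
        exact this ▸ hφQ.mem hzQ
    have hsN' : s ∈ relNormalizer S Q₀ := ⟨hs, hsQ₀⟩
    refine ⟨χ s, hM (hχ.mem hsN'), hχ.mem_normalizer hP₀N hχP hsN' hsN, fun x => ?_⟩
    rw [Function.comp_apply, hsx, hχ.map_conj hsN' (hP₀N (hφ.mem x.2)), Function.comp_apply]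
  refine ⟨R, isConj_iff.2 ⟨_, hE⟩, hfa.1, receptive_of_exists_extension (hRM.trans hM) ?_⟩
  intro U θ hθ
  have hQU : Q ≤ U := by
    obtain ⟨g, hg, hgθ, hθg⟩ := hθ.exists_inverse
    intro x hx
    have h1 := hg.image_of_normalizer hQR
    rw [← SetLike.mem_coe, ← h1] at hx
    obtain ⟨y, hy, rfl⟩ := hx
    exact hg.mem (hQR hy)
  have hθQ := hθ.image_of_normalizer hQU
  obtain ⟨ξ, hξ, hξχ, hχξ⟩ := hχP.exists_inverse
  obtain ⟨φ', hφ', hφφ, hφφ'⟩ := hφ.exists_inverse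
  have hζ : F.IsoOn (ξ ∘ θ) U P₀ := hξ.comp hθ.of_normalizer
  obtain ⟨ψ, N, V, hψ, hUN, hψξ, hN⟩ := hP₀'.exists_extension hζ
  have hdom : ∀ g, ExtendsAt (relNormalizer S Q) θ U R g → g ∈ N ⊓ relNormalizer S Q := by
    rintro g ⟨hgT, hgN, h, hhT, hhN, hh⟩
    refine ⟨hN g ?_, hgT⟩
    obtain ⟨b, hb, hbx⟩ := hfa.2 h hhT hhN
    obtain ⟨s, hs, hsN, hsx⟩ := hφB b hb
    refine ⟨hgT.1, hgN, s, hs, hsN, fun x hx => ?_⟩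
    -- both sides have the same image under the injective map `χ`
    have hgx := conj_mem_of_mem_normalizer hgN hx
    refine hχP.injOn (hζ.mem hgx) (conj_mem_of_mem_normalizer hsN (hζ.mem hx)) ?_
    have hy : ξ (θ x) ∈ P₀ := hζ.mem hx
    obtain ⟨z, hz, hzy⟩ := hφ.exists_eq hy
    have h1 := hbx ⟨z, hz⟩
    rw [Function.comp_apply, Function.comp_apply, hsx ⟨z, hz⟩] at h1
    simp only [Function.comp_apply]
    simp only [hzy] at h1
    rw [hχξ _ (hθ.mem hgx), hh x hx, h1, hχξ _ (hθ.mem hx)]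
  have hUT : U ≤ relNormalizer S Q := hθ.le_left
  obtain ⟨V₁, -, hψ₁⟩ := hψ.restrict (R := N ⊓ relNormalizer S Q) inf_le_left
  have hψQ : F.IsoOn ψ Q Q₀ := by
    refine hψ₁.restrict_of_image (hQU.trans (le_inf hUN hUT)) ?_
    have h1 : ψ '' Q = ξ '' (θ '' Q) := by
      rw [Set.image_image]
      exact Set.image_congr fun x hx => hψξ x (hQU hx)
    rw [h1, hθQ, ← hχQ.image, Set.image_image]
    ext x
    constructor
    · rintro ⟨y, hy, rfl⟩
      dsimp only
      rw [hξχ y (hQ₀ hy)]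
      exact hy
    · exact fun hx => ⟨x, hx, hξχ x (hQ₀ hx)⟩
  have hV₁ : V₁ ≤ relNormalizer S Q₀ := by
    intro y hy
    refine ⟨hψ₁.le_right hy, ?_⟩
    obtain ⟨x, hx, rfl⟩ := hψ₁.exists_eq hy
    exact hψ₁.mem_normalizer (hQU.trans (le_inf hUN hUT)) hψQ hx hx.2.2
  obtain ⟨W, hWM, hχV⟩ := hχ.restrict hV₁
  refine ⟨χ ∘ ψ, _, W, isoOn_normalizer_of_isoOn (hχV.comp hψ₁) (hQU.trans (le_inf hUN hUT))
    inf_le_right (hWM.trans hM) (hχQ.comp hψQ).image, fun x hx => ?_, hdom⟩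
  rw [Function.comp_apply, hψξ x hx, Function.comp_apply, hχξ _ (hθ.mem hx)]

/-! ### Centric radical subgroups and normal subgroups -/

/-- Radicality in terms of `Aut_F(Q)`: every normal `p`-subgroup is contained in `Inn(Q)`. -/
theorem radical_iff [Finite S] (hS : IsPGroup p S) : F.Radical p Q ↔ ∃ hQ : Q ≤ S,
    ∀ N : Subgroup (MulAut Q), N ≤ F.aut hQ → IsPGroup p N →
      (∀ a ∈ F.aut hQ, ∀ n ∈ N, a * n * a⁻¹ ∈ N) → N ≤ (MulAut.conj (G := Q)).range := by
  have hinn : ∀ hQ : Q ≤ S, IsPGroup p (F.inn hQ) := fun hQ => by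
    refine IsPGroup.comap_of_injective ?_ _ (F.aut hQ).subtype_injective
    exact (hS.to_le hQ).of_surjective _ (MulAut.conj (G := Q)).rangeRestrict_surjective
  refine exists_congr fun hQ => (pCore_quotient_eq_bot_iff (hinn hQ)).trans ⟨?_, ?_⟩
  · intro h N hN hNp hnorm n hn
    exact h (N.subgroupOf (F.aut hQ)) ⟨fun m hm a => hnorm a a.2 m hm⟩
      (hNp.comap_of_injective _ (F.aut hQ).subtype_injective) (show ⟨n, hN hn⟩ ∈ _ from hn)
  · intro h N hN hNp n hn
    refine h (N.map (F.aut hQ).subtype) (Subgroup.map_subtype_le N) (hNp.map _) ?_ ⟨n, hn, rfl⟩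
    rintro a ha _ ⟨m, hm, rfl⟩
    exact ⟨⟨a, ha⟩ * m * ⟨a, ha⟩⁻¹, hN.conj_mem m hm _, rfl⟩

theorem Centric.inf_centralizer_le (hQ : F.Centric Q) :
    S ⊓ Subgroup.centralizer (Q : Set G) ≤ Q := by
  rw [hQ.2 Q (isConj_iff.2 ⟨_, IsoOn.id hQ.1⟩)]
  exact Subgroup.map_subtype_le _

/-- If `c_g` is an inner automorphism of the self-centralising subgroup `Q` then `g ∈ Q`. -/
theorem mem_of_conj_eq_inner (hQS : Q ≤ S) (hQ : S ⊓ Subgroup.centralizer (Q : Set G) ≤ Q)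
    {s : G} (hs : s ∈ S) {q : Q}
    (hq : ∀ x : Q, (q * x * (q : G)⁻¹ : G) = s * x * s⁻¹) : s ∈ Q := by
  have h1 : (q : G)⁻¹ * s ∈ Q := by
    refine hQ ⟨S.mul_mem (S.inv_mem (hQS q.2)) hs, ?_⟩
    refine Subgroup.mem_centralizer_iff.2 fun x hx => ?_
    have h2 := hq ⟨x, hx⟩
    simp only at h2
    have h3 : s * x = q * x * (q : G)⁻¹ * s := by rw [h2]; group
    rw [mul_assoc, h3]
    group
  have h2 := Q.mul_mem q.2 h1
  simpa using h2

/-- If every element of `Aut_F(Q)` extends to a morphism stabilising `R`, then `Aut_R(Q)` is a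
normal `p`-subgroup of `Aut_F(Q)`, which forces `N_R(Q) ≤ Q` for a self-centralising radical `Q`. -/
theorem inf_normalizer_le_of_extends [Finite S] (hS : IsPGroup p S)
    (hQ : S ⊓ Subgroup.centralizer (Q : Set G) ≤ Q) (hrad : F.Radical p Q) (hR : R ≤ S)
    (hext : ∀ f, F.IsoOn f Q Q → ∃ f' M N, F.IsoOn f' M N ∧ Q ≤ M ∧ R ≤ M ∧
      (∀ x ∈ Q, f' x = f x) ∧ f' '' R = R) :
    R ⊓ Subgroup.normalizer (Q : Set G) ≤ Q := by
  obtain ⟨hQS, hrad⟩ := (radical_iff hS).1 hrad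
  have hinn := hrad (autBy R Q) (autBy_le_aut hQS hR) (isPGroup_autBy (hS.to_le hR)) (by
    intro a ha n hn
    obtain ⟨g, hgR, hgN, hg⟩ := mem_autBy.1 hn
    obtain ⟨f, hf, haf⟩ := exists_isoOn_of_mem_aut ha
    obtain ⟨f', M, N, hf', hQM, hRM, hff, hfR⟩ := hext f hf
    have hfQ : F.IsoOn f' Q Q := hf.congr hff
    refine mem_autBy.2 ⟨f' g, hfR.le ⟨g, hgR, rfl⟩, hf'.mem_normalizer hQM hfQ (hRM hgR) hgN, ?_⟩
    intro y
    obtain ⟨x, rfl⟩ := a.surjective y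
    have h1 : (a * n * a⁻¹) (a x) = a (n x) := by simp
    rw [h1, haf, haf, hg, ← hff _ (conj_mem_of_mem_normalizer hgN x.2), ← hff _ x.2,
      hf'.map_conj (hRM hgR) (hQM x.2)])
  rintro g ⟨hgR, hgN⟩
  obtain ⟨a, -, hag⟩ := (IsoOn.of_conj_normalizer (F := F) (hR hgR) hQS hgN).exists_mem_aut
  obtain ⟨q, hq⟩ := hinn (mem_autBy.2 ⟨g, hgR, hgN, hag⟩)
  refine mem_of_conj_eq_inner hQS hQ (hR hgR) (q := q) fun x => ?_
  rw [← hag, ← hq]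
  rfl

/-- Normal subgroups of `F` lie in every self-centralising radical subgroup. -/
theorem core_le_of_radical [Fact p.Prime] [Finite S] (hS : IsPGroup p S)
    (hQ : S ⊓ Subgroup.centralizer (Q : Set G) ≤ Q) (hrad : F.Radical p Q) : F.core ≤ Q := by
  have hQS : Q ≤ S := hrad.1
  refine sSup_le fun R hR => ?_
  obtain ⟨hRS, hRN, hext⟩ := hR
  have hle : R ⊓ Subgroup.normalizer (Q : Set G) ≤ Q := by
    refine inf_normalizer_le_of_extends hS hQ hrad hRS fun f hf => ?_
    obtain ⟨φ, hφ, hφf⟩ := hf.exists_mem_hom le_rfl hQS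
    obtain ⟨ψ, hψ, hψφ, hψR⟩ := hext Q Q φ hφ
    obtain ⟨f', N, -, hf', hψf⟩ := exists_isoOn_of_mem_hom hψ
    refine ⟨f', _, N, hf', le_sup_left, le_sup_right, fun x hx => ?_, ?_⟩
    · rw [← hφf ⟨x, hx⟩, ← hψφ ⟨x, hx⟩ ⟨x, (le_sup_left : Q ≤ Q ⊔ R) hx⟩ rfl, hψf]
    · rw [← hψR]
      ext z
      constructor
      · rintro ⟨x, hx, rfl⟩
        exact ⟨⟨x, (le_sup_right : R ≤ Q ⊔ R) (hψR.le hx)⟩, hψR.le hx, hψf _⟩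
      · rintro ⟨x, hx, rfl⟩
        exact ⟨x, hψR.ge hx, (hψf x).symm⟩
  -- otherwise `Q` is properly contained in `N_{QR}(Q) = Q N_R(Q)`
  by_contra hRQ
  have hfin : Finite ↥(Q ⊔ R) := finite_of_le (sup_le hQS hRS)
  obtain ⟨g, hg, hgN, hgQ⟩ := (hS.to_le (sup_le hQS hRS)).exists_mem_normalizer_notMem
    (lt_of_le_of_ne (le_sup_left : Q ≤ Q ⊔ R) fun h => hRQ (h ▸ le_sup_right))
  have hg' : g ∈ (Q : Set G) * (R : Set G) := by
    rw [← Subgroup.coe_mul_of_left_le_normalizer_right _ _ (hQS.trans hRN)]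
    exact hg
  obtain ⟨q, hq, r, hr, rfl⟩ := hg'
  refine hgQ (Q.mul_mem hq (hle ⟨hr, ?_⟩))
  have h1 := Subgroup.mul_mem _ (Subgroup.inv_mem _ (Subgroup.le_normalizer hq)) hgN
  simpa using h1

/-- A centric radical subgroup all of whose `F`-automorphisms extend to `S` is equal to `S`. -/
theorem eq_of_extends [Fact p.Prime] [Finite S] (hS : IsPGroup p S)
    (hQ : S ⊓ Subgroup.centralizer (Q : Set G) ≤ Q) (hrad : F.Radical p Q)
    (hext : ∀ f, F.IsoOn f Q Q → ∃ f', F.IsoOn f' S S ∧ ∀ x ∈ Q, f' x = f x) : Q = S := by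
  have hQS : Q ≤ S := hrad.1
  by_contra hne
  obtain ⟨g, hg, hgN, hgQ⟩ := hS.exists_mem_normalizer_notMem (lt_of_le_of_ne hQS hne)
  refine hgQ (inf_normalizer_le_of_extends hS hQ hrad le_rfl (fun f hf => ?_) ⟨hg, hgN⟩)
  obtain ⟨f', hf', hff⟩ := hext f hf
  exact ⟨f', S, S, hf', hQS, le_rfl, hff, hf'.image⟩

theorem aut_normalizer (hQ : Q ≤ S) :
    (F.normalizer Q hQ).aut (le_inf hQ Subgroup.le_normalizer) = F.aut hQ := by
  have hQN : Q ≤ relNormalizer S Q := le_inf hQ Subgroup.le_normalizer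
  ext a
  constructor
  · intro ha
    obtain ⟨f, hf, haf⟩ := exists_isoOn_of_mem_aut ha
    exact (mem_aut_iff haf).2 hf.of_normalizer
  · intro ha
    obtain ⟨f, hf, haf⟩ := exists_isoOn_of_mem_aut ha
    exact (mem_aut_iff haf).2 (isoOn_normalizer_of_isoOn hf le_rfl hQN hQN hf.image)

theorem core_normalizer [Fact p.Prime] [Finite S] (hS : IsPGroup p S)
    (hQ : F.Centric Q) (hrad : F.Radical p Q) : (F.normalizer Q hQ.1).core = Q := by
  refine le_antisymm ?_ (F.le_core_normalizer Q hQ.1)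
  have hT : IsPGroup p (relNormalizer S Q) := hS.to_le inf_le_left
  refine core_le_of_radical hT
    ((inf_le_inf_right _ inf_le_left).trans hQ.inf_centralizer_le) ?_
  obtain ⟨hQS, h⟩ := (radical_iff hS).1 hrad
  refine (radical_iff hT).2 ⟨le_inf hQS Subgroup.le_normalizer, ?_⟩
  rwa [aut_normalizer]

theorem core_normalizer_self : (F.normalizer S le_rfl).core = relNormalizer S S :=
  le_antisymm (core_le _) (inf_le_left.trans (F.le_core_normalizer S le_rfl))

theorem essential_subset_fcr [Fact p.Prime] [Finite S] : F.essential p ⊆ F.fcr p := by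
  rintro Q ⟨hn, hc, hQ, H, hH⟩
  have := finite_mulAut hQ
  exact ⟨hn, hc, hQ, hH.pCore_eq_bot⟩

theorem autBy_self_le_range : autBy Q Q ≤ (MulAut.conj (G := Q)).range := by
  intro a ha
  obtain ⟨g, hg, -, h⟩ := mem_autBy.1 ha
  refine ⟨⟨g, hg⟩, ?_⟩
  ext x
  exact (h x).symm

/-- `Out_F(S)` is a `p'`-group, so `S` is not essential. -/
theorem self_notMem_essential [Fact p.Prime] [Finite S] (hS : F.FullyAutomised p S) :
    S ∉ F.essential p := by
  rintro ⟨-, -, hSS, H, -, hdvd, -⟩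
  have := finite_mulAut hSS
  obtain ⟨hSS', T, hT⟩ := hS
  obtain ⟨x, hx⟩ := exists_prime_orderOf_dvd_card' p hdvd
  have h1 : p ∣ (F.inn hSS).index := by
    have h2 := orderOf_dvd_natCard (x : F.Out hSS)
    rw [Subgroup.orderOf_coe, hx] at h2
    exact h2
  have h3 : (T : Subgroup (F.aut hSS)) ≤ F.inn hSS := by
    rw [hT]
    exact Subgroup.comap_mono autBy_self_le_range
  exact T.not_dvd_index (h1.trans (Subgroup.index_dvd_of_le h3))

/-! ### Alperin's fusion theorem -/

/-- The restriction of `f` to `P` is the restriction of an element of `Aut_F(S)`. -/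
def ExtendsToTop (F : FusionSystem S) (f : G → G) (P : Subgroup G) : Prop :=
  ∃ f', F.IsoOn f' S S ∧ ∀ x ∈ P, f' x = f x

/-- The subgroup of `Aut_F(Q)` formed by the automorphisms that extend to `S`. -/
def extendableAut (F : FusionSystem S) (hQ : Q ≤ S) : Subgroup (F.aut hQ) where
  carrier := {a | ∃ f, F.IsoOn f S S ∧ ∀ x : Q, ((a : MulAut Q) x : G) = f x}
  one_mem' := ⟨id, IsoOn.id le_rfl, fun _ => rfl⟩
  mul_mem' := by
    rintro a b ⟨f, hf, haf⟩ ⟨g, hg, hbg⟩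
    refine ⟨f ∘ g, hf.comp hg, fun x => ?_⟩
    rw [Function.comp_apply, ← hbg, ← haf]
    rfl
  inv_mem' := by
    rintro a ⟨f, hf, haf⟩
    obtain ⟨g, hg, hgf, -⟩ := hf.exists_inverse
    refine ⟨g, hg, fun x => ?_⟩
    obtain ⟨y, rfl⟩ := (a : MulAut Q).surjective x
    rw [haf, hgf _ (hQ y.2), Subgroup.coe_inv, MulAut.inv_apply_self]

/-- For a fully automised receptive `Q < S`, suppose that isomorphisms between overgroups of `Q`
extend to `S`. If `Q` is not centric, every element of `Aut_F(Q)` extends to the larger group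
`Q C_S(Q)`; if `Q` is centric and some element of `Aut_F(Q)` does not extend to `S`, then the
extendable ones form a strongly `p`-embedded subgroup of `Out_F(Q)`. -/
theorem extendsToTop_of_notMem_essential [Fact p.Prime] [Finite S] (hS : IsPGroup p S)
    (hQa : F.FullyAutomised p Q) (hQr : F.Receptive Q) (hQS : Q < S) (hQ : Q ∉ F.essential p)
    (ih : ∀ f P R, F.IsoOn f P R → Q < P → F.ExtendsToTop f P) (hf : F.IsoOn f Q Q) :
    F.ExtendsToTop f Q := by
  -- an automorphism with `N_f > Q` extends to a larger subgroup, hence to `S`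
  have step : ∀ f, F.IsoOn f Q Q → ∀ g ∉ Q, ExtendsAt S f Q Q g → F.ExtendsToTop f Q := by
    intro f hf g hg hgf
    obtain ⟨f', N, R, hf', hQN, hff, hN⟩ := hQr.exists_extension hf
    obtain ⟨f'', hf'', hff'⟩ := ih f' N R hf'
      (lt_of_le_of_ne hQN fun h => hg (h ▸ hN g hgf))
    exact ⟨f'', hf'', fun x hx => (hff' x (hQN hx)).trans (hff x hx)⟩
  by_cases hc : F.Centric Q
  · by_contra hnot
    have := finite_mulAut hQS.le
    refine hQ ⟨fullyNormalised_of_fullyAutomised_of_receptive hS hQa hQr, hc, hQS.le, _,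
      stronglyEmbedded_map_mk (I := F.inn hQS.le) (H := F.extendableAut hQS.le)
        (P := (autBy S Q).subgroupOf (F.aut hQS.le)) ?_ ?_ ?_ ?_ ?_ ?_ ?_⟩
    · refine IsPGroup.comap_of_injective ?_ _ (F.aut hQS.le).subtype_injective
      exact (hS.to_le hQS.le).of_surjective _ (MulAut.conj (G := Q)).rangeRestrict_surjective
    · rintro ⟨_, ha⟩ ⟨q, rfl⟩
      exact ⟨_, IsoOn.of_conj_normalizer (hQS.le q.2) le_rfl
        (Subgroup.le_normalizer (hQS.le q.2)), fun x => rfl⟩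
    · obtain ⟨a, ha, haf⟩ := hf.exists_mem_aut
      rw [lt_top_iff_ne_top]
      intro htop
      have h1 : (⟨a, ha⟩ : F.aut hQS.le) ∈ F.extendableAut hQS.le := htop ▸ Subgroup.mem_top _
      obtain ⟨f', hf', haf'⟩ := h1
      exact hnot ⟨f', hf', fun x hx => (haf' ⟨x, hx⟩).symm.trans (haf ⟨x, hx⟩)⟩
    · obtain ⟨hQS', T, hT⟩ := hQa
      rw [← hT]
      exact ⟨le_top, T.isPGroup', fun C _ hC hTC => T.is_maximal' hC hTC⟩
    · rintro ⟨a, ha⟩ haS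
      obtain ⟨g, hg, -, hag⟩ := mem_autBy.1 (show a ∈ autBy S Q from haS)
      exact ⟨_, IsoOn.of_conj_normalizer hg le_rfl (Subgroup.le_normalizer hg), hag⟩
    · intro hle
      obtain ⟨g, hg, hgN, hgQ⟩ := hS.exists_mem_normalizer_notMem hQS
      obtain ⟨a, ha, hag⟩ := (IsoOn.of_conj_normalizer (F := F) hg hQS.le hgN).exists_mem_aut
      obtain ⟨q, hq⟩ := hle (show (⟨a, ha⟩ : F.aut hQS.le) ∈ _ from mem_autBy.2 ⟨g, hg, hgN, hag⟩)
      have hq' : MulAut.conj q = a := hq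
      refine hgQ (mem_of_conj_eq_inner hQS.le hc.inf_centralizer_le hg (q := q) fun x => ?_)
      rw [← hag, ← hq']
      rfl
    · rintro ⟨z, hz⟩ ⟨⟨a, ha⟩, haS, haI, hza⟩
      obtain ⟨s, hs, hsN, has⟩ := mem_autBy.1 (show a ∈ autBy S Q from haS)
      obtain ⟨t, ht, htN, hzt⟩ := mem_autBy.1 (show z * a * z⁻¹ ∈ autBy S Q from hza)
      obtain ⟨f, hf, hzf⟩ := exists_isoOn_of_mem_aut hz
      have hsQ : s ∉ Q := fun hsQ =>
        haI (autBy_self_le_range (mem_autBy.2 ⟨s, hsQ, hsN, has⟩))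
      have hst : ∀ x ∈ Q, f (s * x * s⁻¹) = t * f x * t⁻¹ := by
        intro x hx
        have h1 := hzt (z ⟨x, hx⟩)
        have h2 : (z * a * z⁻¹) (z ⟨x, hx⟩) = z (a ⟨x, hx⟩) := by simp
        rwa [h2, hzf, hzf, has] at h1
      obtain ⟨f', hf', hff⟩ := step f hf s hsQ ⟨hs, hsN, t, ht, htN, hst⟩
      exact ⟨f', hf', fun x => (hzf x).trans (hff x x.2).symm⟩
  · have hex : ∃ P, F.IsConj P Q ∧ ∃ c ∈ S, c ∈ Subgroup.centralizer (P : Set G) ∧ c ∉ P := by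
      by_contra hno
      push Not at hno
      refine hc ⟨hQS.le, fun P hPQ => le_antisymm ?_ ?_⟩
      · rintro c ⟨hcS, hcP⟩
        refine ⟨⟨c, hno P hPQ c hcS hcP⟩, ?_, rfl⟩
        rw [SetLike.mem_coe, Subgroup.mem_center_iff]
        exact fun x => Subtype.ext (Subgroup.mem_centralizer_iff.1 hcP x x.2)
      · rintro _ ⟨c, hcZ, rfl⟩
        obtain ⟨e, he⟩ := hPQ
        refine ⟨F.le_left he.1 c.2, Subgroup.mem_centralizer_iff.2 fun x hx => ?_⟩
        exact congrArg Subtype.val (Subgroup.mem_center_iff.1 hcZ ⟨x, hx⟩)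
    obtain ⟨P, hPQ, c, hcS, hcP, hc⟩ := hex
    obtain ⟨φ, hφ⟩ := isConj_iff.1 hPQ
    obtain ⟨ψ, N, R, hψ, hPN, hψφ, hN⟩ := hQr.exists_extension hφ
    have hconj : ∀ x ∈ P, c * x * c⁻¹ = x := fun x hx => by
      rw [← Subgroup.mem_centralizer_iff.1 hcP x hx, mul_inv_cancel_right]
    have hcN : c ∈ N := hN c ⟨hcS, Subgroup.centralizer_le_normalizer _ hcP, 1, S.one_mem,
      Subgroup.one_mem _, fun x hx => by rw [hconj x hx]; simp⟩
    have hψQ : F.IsoOn ψ P Q := hφ.congr hψφ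
    have hconj' : ∀ y ∈ Q, ψ c * y * (ψ c)⁻¹ = y := by
      intro y hy
      obtain ⟨x, hx, rfl⟩ := hψQ.exists_eq hy
      rw [← hψ.map_conj hcN (hPN hx), hconj x hx]
    refine step f hf (ψ c) (fun hcQ => ?_) ⟨hψ.le_right (hψ.mem hcN), ?_, 1, S.one_mem,
      Subgroup.one_mem _, fun x hx => by rw [hconj' x hx]; simp⟩
    · obtain ⟨x, hx, hxc⟩ := hψQ.exists_eq hcQ
      exact hc (hψ.injOn (hPN hx) hcN hxc ▸ hx)
    · exact hψ.mem_normalizer hPN hψQ hcN (Subgroup.centralizer_le_normalizer _ hcP)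

/-- A form of Alperin's fusion theorem: if a class `X` of subgroups is closed under conjugation
in `F` and under overgroups, `F` is saturated on `X` and `X` contains no essential subgroup,
then every isomorphism between members of `X` extends to `S`. -/
theorem extendsToTop_of_disjoint_essential [Fact p.Prime] [Finite S] (hS : IsPGroup p S)
    (X : Set (Subgroup G)) (hconj : ∀ f P Q, F.IsoOn f P Q → P ∈ X → Q ∈ X)
    (hup : ∀ P ∈ X, ∀ Q, P ≤ Q → Q ∈ X)
    (hsat : ∀ P ∈ X, P ≤ S → ∃ Q, F.IsConj P Q ∧ F.FullyAutomised p Q ∧ F.Receptive Q)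
    (hess : ∀ Q ∈ X, Q ∉ F.essential p) (hf : F.IsoOn f P Q) (hP : P ∈ X) :
    F.ExtendsToTop f P := by
  induction hn : Nat.card S - Nat.card P using Nat.strong_induction_on generalizing f P Q with
  | _ n ih =>
  have hPS := hf.le_left
  have ih' : ∀ U : Subgroup G, Nat.card U = Nat.card P → U ∈ X → ∀ f V W, F.IsoOn f V W → U < V →
      F.ExtendsToTop f V := by
    intro U hU hUX f V W hf hUV
    have h1 : Nat.card V ≤ Nat.card S := Subgroup.card_le_of_le hf.le_left
    have h2 : Nat.card U < Nat.card V := by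
      have := finite_of_le hf.le_left
      by_contra hle
      exact hUV.ne (Subgroup.eq_of_le_of_card_ge hUV.le (not_lt.1 hle))
    exact ih _ (by omega) hf (hup U hUX V hUV.le) rfl
  have htop : ∀ U ≤ S, Nat.card S ≤ Nat.card U → U = S := fun U hU h =>
    Subgroup.eq_of_le_of_card_ge hU h
  rcases eq_or_lt_of_le hPS with rfl | hlt
  · have hQ : Q = P := htop Q hf.le_right hf.card_eq.le
    rw [hQ] at hf
    exact ⟨f, hf, fun _ _ => rfl⟩
  have hcard : Nat.card P < Nat.card S := by
    by_contra h
    exact hlt.ne (htop P hPS (not_lt.1 h))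
  obtain ⟨Q₀, hPQ₀, hQ₀a, hQ₀r⟩ := hsat P hP hPS
  obtain ⟨θ, hθ⟩ := isConj_iff.1 hPQ₀
  have hQ₀X := hconj θ P Q₀ hθ hP
  have hQ₀S : Q₀ < S := lt_of_le_of_ne hQ₀r.1 fun h => by
    rw [← h, hθ.card_eq] at hcard
    exact hcard.false
  have aux : ∀ U : Subgroup G, Nat.card U = Nat.card P → U ∈ X → F.IsConj U Q₀ →
      ∃ g, F.IsoOn g U Q₀ ∧ F.IsoOn g S S := by
    intro U hU hUX hUQ
    obtain ⟨g, hg, R, -, hgN⟩ := exists_extension_relNormalizer hS hQ₀a hQ₀r hUQ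
    have hUS : U < S := lt_of_le_of_ne hg.le_left fun h => by
      rw [← hU, h] at hcard
      exact hcard.false
    obtain ⟨x, hx, hxN, hxU⟩ := hS.exists_mem_normalizer_notMem hUS
    have hle : U ≤ relNormalizer S U := le_inf hUS.le Subgroup.le_normalizer
    obtain ⟨g', hg', hgg⟩ := ih' U hU hUX g _ R hgN
      (lt_of_le_of_ne hle fun h => hxU (h ▸ ⟨hx, hxN⟩))
    exact ⟨g', hg.congr fun x hx => hgg x (hle hx), hg'⟩
  obtain ⟨g₁, hg₁, hg₁S⟩ := aux P rfl hP hPQ₀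
  obtain ⟨f', hf', hff, -⟩ := hf.exists_inverse
  obtain ⟨g₂, hg₂, hg₂S⟩ := aux Q hf.card_eq.symm (hconj f P Q hf hP)
    (isConj_iff.2 ⟨_, hθ.comp hf'⟩)
  obtain ⟨k₁, hk₁, hkg₁, -⟩ := hg₁.exists_inverse
  obtain ⟨k₂, hk₂, hkg₂, -⟩ := hg₂S.exists_inverse
  -- `f` differs from an automorphism of `Q₀` by maps that extend to `S`
  obtain ⟨a, ha, haf⟩ := extendsToTop_of_notMem_essential hS hQ₀a hQ₀r hQ₀S (hess Q₀ hQ₀X)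
    (ih' Q₀ hθ.card_eq.symm hQ₀X) ((hg₂.comp hf).comp hk₁)
  refine ⟨k₂ ∘ a ∘ g₁, hk₂.comp (ha.comp hg₁S), fun x hx => ?_⟩
  simp only [Function.comp_apply]
  rw [haf _ (hg₁.mem hx)]
  simp only [Function.comp_apply]
  rw [hkg₁ x hx, hkg₂ _ (hf.le_right (hf.mem hx))]

theorem isNormal_self_of_extends
    (h : ∀ U V φ, φ ∈ F.Hom U V → ∃ f, F.IsoOn f S S ∧ ∀ x : U, (φ x : G) = f x) :
    F.IsNormal S := by
  refine ⟨le_rfl, Subgroup.le_normalizer, fun U V φ hφ => ?_⟩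
  obtain ⟨f, hf, hφf⟩ := h U V φ hφ
  have hU : U ⊔ S = S := sup_eq_right.2 (F.le_left hφ)
  have hV : V ⊔ S = S := sup_eq_right.2 (F.le_right hφ)
  unfold ExtendsStabilising
  rw [hU, hV]
  obtain ⟨ψ, hψ, hψf⟩ := hf.exists_mem_hom le_rfl le_rfl
  refine ⟨ψ, hψ, fun x y hxy => by rw [hψf, hφf, hxy], SetLike.coe_injective ?_⟩
  refine Eq.trans ?_ hf.image
  ext z
  constructor
  · rintro ⟨x, -, rfl⟩
    exact ⟨x, x.2, (hψf x).symm⟩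
  · rintro ⟨x, hx, rfl⟩
    exact ⟨⟨x, hx⟩, hx, hψf _⟩

/-- A fully normalised centric radical subgroup in a class as in Alperin's fusion theorem is equal
to `S`. -/
theorem eq_of_mem_fcr_of_disjoint_essential [Fact p.Prime] [Finite S] (hS : IsPGroup p S)
    (X : Set (Subgroup G)) (hconj : ∀ f P Q, F.IsoOn f P Q → P ∈ X → Q ∈ X)
    (hup : ∀ P ∈ X, ∀ Q, P ≤ Q → Q ∈ X)
    (hsat : ∀ P ∈ X, P ≤ S → ∃ Q, F.IsConj P Q ∧ F.FullyAutomised p Q ∧ F.Receptive Q)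
    (hess : ∀ Q ∈ X, Q ∉ F.essential p) (hQ : Q ∈ F.fcr p) (hQX : Q ∈ X) : Q = S :=
  eq_of_extends hS hQ.2.1.inf_centralizer_le hQ.2.2 fun _ hf =>
    extendsToTop_of_disjoint_essential hS X hconj hup hsat hess hf hQX

theorem fullyAutomised_self_of_exists [Finite S]
    (h : ∃ Q, F.IsConj S Q ∧ F.FullyAutomised p Q ∧ F.Receptive Q) : F.FullyAutomised p S := by
  obtain ⟨Q, hSQ, hQ, -⟩ := h
  obtain ⟨f, hf⟩ := isConj_iff.1 hSQ
  obtain rfl := Subgroup.eq_of_le_of_card_ge hf.le_right hf.card_eq.le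
  exact hQ

/-! ### The local rank -/

theorem localRank_eq_zero_iff [Finite S] : F.localRank p = 0 ↔ F.core = S := by
  rw [localRank]
  split_ifs with h <;> simp [h]

theorem finite_fcr_index [Finite S] : Finite {R : Subgroup G // R ∈ F.fcr p ∧ F.core < R} := by
  refine Finite.of_injective (fun R => R.1.subgroupOf S) fun R R' h => Subtype.ext ?_
  have h1 := congrArg (Subgroup.map S.subtype) h
  simp only [Subgroup.subgroupOf_map_subtype] at h1
  rwa [inf_eq_left.2 R.2.1.1.1, inf_eq_left.2 R'.2.1.1.1] at h1

theorem localRank_normalizer_lt [Finite S] (hR : R ∈ F.fcr p) (hlt : F.core < R) :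
    (F.normalizer R hR.1.1).localRank p < F.localRank p := by
  have hne : F.core ≠ S := (hlt.trans_le hR.1.1).ne
  have := finite_fcr_index (F := F) (p := p)
  rw [localRank.eq_1 p F, if_neg hne, add_comm, Nat.lt_succ_iff]
  exact le_ciSup (f := fun R : {R : Subgroup G // R ∈ F.fcr p ∧ F.core < R} =>
    (F.normalizer R.1 R.2.1.1.1).localRank p) (Set.finite_range _).bddAbove ⟨R, hR, hlt⟩

theorem localRank_le_succ [Finite S] {n : ℕ} (h : ∀ R (hR : R ∈ F.fcr p), F.core < R →
    (F.normalizer R hR.1.1).localRank p ≤ n) : F.localRank p ≤ n + 1 := by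
  rw [localRank.eq_1 p F]
  split_ifs
  · exact Nat.zero_le _
  · rw [add_comm]
    exact Nat.succ_le_succ (ciSup_le' fun R => h R.1 R.2.1 R.2.2)

theorem localRank_normalizer_of_eq [Finite S] (hQS : Q ≤ S) (hQ : Q = S) :
    (F.normalizer Q hQS).localRank p = 0 := by
  subst hQ
  exact localRank_eq_zero_iff.2 core_normalizer_self

theorem lt_relNormalizer [Fact p.Prime] [Finite S] (hS : IsPGroup p S) (hQ : Q < S) :
    Q < relNormalizer S Q := by
  obtain ⟨g, hg, hgN, hgQ⟩ := hS.exists_mem_normalizer_notMem hQ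
  exact lt_of_le_of_ne (le_inf hQ.le Subgroup.le_normalizer) fun h => hgQ (h ▸ ⟨hg, hgN⟩)

theorem core_lt_of_mem_fcr [Fact p.Prime] [Finite S] (hS : IsPGroup p S) (hQ : Q ∈ F.fcr p)
    (hne : Q ≠ F.core) : F.core < Q :=
  lt_of_le_of_ne (core_le_of_radical hS hQ.2.1.inf_centralizer_le hQ.2.2) hne.symm

theorem lt_of_isoOn_normalizer {hQ : Q ≤ S} {U V : Subgroup G} (hQU : Q < U)
    (hf : (F.normalizer Q hQ).IsoOn f U V) : Q < V := by
  have him := hf.image_of_normalizer hQU.le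
  refine lt_of_le_of_ne (fun x hx => ?_) ?_
  · rw [← SetLike.mem_coe, ← him] at hx
    obtain ⟨y, hy, rfl⟩ := hx
    exact hf.mem (hQU.le hy)
  · rintro rfl
    refine hQU.not_ge fun x hx => ?_
    obtain ⟨y, hy, hyx⟩ := him.ge (hf.mem hx)
    exact hf.injOn (hQU.le hy) hx hyx ▸ hy

/-- If no subgroup other than `Q` is essential in `N_F(Q)`, then Alperin's theorem, applied to the
proper overgroups of `Q = O_p(N_F(Q))`, leaves `N_S(Q)` as the only fully normalised centric radical
subgroup among them, and its normaliser has local rank zero. -/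
theorem localRank_normalizer_le_one [Fact p.Prime] [Finite S] (hS : IsPGroup p S)
    (hF : F.Saturated p) (hQ : Q ∈ F.fcr p) (h : (F.normalizer Q hQ.1.1).essential p ⊆ {Q}) :
    (F.normalizer Q hQ.1.1).localRank p ≤ 1 := by
  refine localRank_le_succ fun R hR hlt => (localRank_normalizer_of_eq _ ?_).le
  rw [core_normalizer hS hQ.2.1 hQ.2.2] at hlt
  exact eq_of_mem_fcr_of_disjoint_essential (hS.to_le inf_le_left) {P | Q < P}
    (fun f U V hf hU => lt_of_isoOn_normalizer hU hf) (fun U hU V hUV => lt_of_lt_of_le hU hUV)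
    (fun U hU hUS => exists_isConj_normalizer hS hF hQ.1 (le_of_lt hU) hUS)
    (fun U hU hUe => (ne_of_lt hU) (h hUe).symm) hR hlt

/-- `N_F(Q)` has an essential subgroup when `Q < S`: otherwise all its morphisms would extend to
`N_S(Q)`, and `O_p(N_F(Q)) = Q` would be equal to `N_S(Q)`. -/
theorem essential_normalizer_nonempty [Fact p.Prime] [Finite S] (hS : IsPGroup p S)
    (hF : F.Saturated p) (hQ : Q ∈ F.fcr p) (hlt : Q < S) :
    ((F.normalizer Q hQ.1.1).essential p).Nonempty := by
  by_contra hempty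
  rw [Set.not_nonempty_iff_eq_empty] at hempty
  have hT : IsPGroup p (relNormalizer S Q) := hS.to_le inf_le_left
  have hnormal : (F.normalizer Q hQ.1.1).IsNormal (relNormalizer S Q) := by
    refine isNormal_self_of_extends fun U V φ hφ => ?_
    obtain ⟨f, R, -, hf, hφf⟩ := exists_isoOn_of_mem_hom hφ
    obtain ⟨f', hf', hff, hfQ⟩ := hf.exists_extension_of_normalizer
    have hQN : Q ≤ relNormalizer S Q := le_inf hQ.1.1 Subgroup.le_normalizer
    obtain ⟨f'', hf'', hff'⟩ := extendsToTop_of_disjoint_essential hT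
      {P | Q ≤ P} (fun f A B hf hA x hx => by
        rw [← SetLike.mem_coe, ← hf.image_of_normalizer hA] at hx
        obtain ⟨y, hy, rfl⟩ := hx
        exact hf.mem (hA hy))
      (fun A hA B hAB => le_trans hA hAB)
      (fun A hA hAS => exists_isConj_normalizer hS hF hQ.1 hA hAS)
      (fun A _ hAe => by simp [hempty] at hAe)
      (isoOn_normalizer_of_isoOn (hQ := hQ.1.1) hf' le_sup_right (sup_le hf.le_left hQN)
        (sup_le hf.le_right hQN) hfQ) (le_sup_right : Q ≤ U ⊔ Q)
    exact ⟨f'', hf'', fun x => by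
      rw [hφf, hff' x ((le_sup_left : U ≤ U ⊔ Q) x.2), hff x x.2]⟩
  have hle : relNormalizer S Q ≤ (F.normalizer Q hQ.1.1).core := le_sSup hnormal
  rw [core_normalizer hS hQ.2.1 hQ.2.2] at hle
  exact (lt_relNormalizer hS hlt).not_ge hle

end FusionSystem

open FusionSystem in
theorem mainTheorem7 {G : Type*} [Group G] (p : ℕ) [Fact p.Prime] (S : Subgroup G) [Finite S]
    (hS : IsPGroup p S) (F : FusionSystem S) (hF : F.Saturated p) :
    F.localRank p = 2 ↔
      (F.essential p \ {F.core}).Nonempty ∧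
      ∀ (Q : Subgroup G) (hQ : Q ∈ F.fcr p \ {S, F.core}),
        (F.normalizer Q hQ.1.1.1).essential p = {Q} := by
  constructor
  · intro hrank
    refine ⟨?_, ?_⟩
    · by_contra hno
      have hess : ∀ Q ∈ F.essential p, Q = F.core := by
        intro Q hQ
        by_contra hne
        exact hno ⟨Q, hQ, hne⟩
      have hle : F.localRank p ≤ 0 + 1 := by
        refine localRank_le_succ fun R hR hlt => (localRank_normalizer_of_eq _ ?_).le
        have hcard : ∀ U V : Subgroup G, U < V → V ≤ S → Nat.card U < Nat.card V := by
          intro U V hUV hV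
          have := finite_of_le hV
          by_contra hle
          exact hUV.ne (Subgroup.eq_of_le_of_card_ge hUV.le (not_lt.1 hle))
        -- this class is closed under conjugation because conjugate subgroups have equal order
        refine eq_of_mem_fcr_of_disjoint_essential hS
          {P | P ≤ S → Nat.card F.core < Nat.card P} ?_ ?_ (fun P _ => hF P) ?_ hR
          fun hRS => hcard _ _ hlt hRS
        · intro f P Q hf hP _
          rw [← hf.card_eq]
          exact hP hf.le_left
        · intro P hP Q hPQ hQS
          have := finite_of_le hQS
          exact (hP (hPQ.trans hQS)).trans_le (Subgroup.card_le_of_le hPQ)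
        · intro Q hQ hQe
          have h1 := hQ hQe.1.1
          rw [hess Q hQe] at h1
          exact h1.false
      omega
    · rintro Q ⟨hQ, hne⟩
      simp only [Set.mem_insert_iff, Set.mem_singleton_iff, not_or] at hne
      have hQS : Q < S := lt_of_le_of_ne hQ.1.1 hne.1
      have hT : IsPGroup p (relNormalizer S Q) := hS.to_le inf_le_left
      have hcore := core_normalizer hS hQ.2.1 hQ.2.2
      have hE := localRank_normalizer_lt hQ (core_lt_of_mem_fcr hS hQ hne.2)
      have hsub : (F.normalizer Q hQ.1.1).essential p ⊆ {Q} := by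
        intro R hRe
        have hR := essential_subset_fcr hRe
        by_contra hRQ
        have hlt := core_lt_of_mem_fcr hT hR (by rw [hcore]; exact hRQ)
        have hE' := localRank_normalizer_lt hR hlt
        have h0 : ((F.normalizer Q hQ.1.1).normalizer R hR.1.1).core =
            relNormalizer (relNormalizer S Q) R := (localRank_eq_zero_iff (p := p)).1 (by omega)
        rw [core_normalizer hT hR.2.1 hR.2.2] at h0
        -- `R` is its own normaliser in the `p`-group `N_S(Q)`
        have hRT : R = relNormalizer S Q := by
          by_contra hne
          exact (lt_relNormalizer hT (lt_of_le_of_ne hR.1.1 hne)).ne h0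
        subst hRT
        exact self_notMem_essential (fullyAutomised_self_of_exists
          (exists_isConj_normalizer hS hF hQ.1 (le_inf hQS.le Subgroup.le_normalizer) le_rfl)) hRe
      exact (Set.Nonempty.subset_singleton_iff
        (essential_normalizer_nonempty hS hF hQ hQS)).1 hsub
  · rintro ⟨⟨Q, hQe, hQc⟩, hloc⟩
    have hQ := essential_subset_fcr hQe
    have hQS : Q ≠ S := by
      rintro rfl
      exact self_notMem_essential (fullyAutomised_self_of_exists (hF Q le_rfl)) hQe
    refine le_antisymm (localRank_le_succ fun R hR hlt => ?_) ?_
    · by_cases hRS : R = S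
      · rw [localRank_normalizer_of_eq _ hRS]
        exact Nat.zero_le _
      · refine localRank_normalizer_le_one hS hF hR (hloc R ⟨hR, ?_⟩).le
        simp [hRS, hlt.ne']
    · have h1 := localRank_normalizer_lt hQ (core_lt_of_mem_fcr hS hQ hQc)
      have h2 : (F.normalizer Q hQ.1.1).localRank p ≠ 0 := by
        rw [Ne, localRank_eq_zero_iff, core_normalizer hS hQ.2.1 hQ.2.2]
        exact (lt_relNormalizer hS (lt_of_le_of_ne hQ.1.1 hQS)).ne
      omega
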